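/- **Setting.** Let $K\ge 2$ and $D\ge 0$ be integers, and let $z^{(q)}=(z^{(q)}_1,\dots,z^{(q)}_K)$ (query slots) and $z^{(c)}=(z^{(c)}_1,\dots,z^{(c)}_K)$ (support slots) be tuples of unit vectors, i.e. points of the unit sphere $\mathcal S^{D-1}\subset\mathbb R^D$. Put $\cos(x,y)=\langle x,y\rangle/(\|x\|\|y\|)$ and $S_{k,k'}=\cos(z^{(q)}_k,z^{(c)}_{k'})$. For $\varepsilon>0$ let $$T(\varepsilon)=\arg\min_{T}\ \langle T,-S\rangle-\varepsilon H(T),\qquad H(T)=-\sum_{k,k'}T_{k,k'}\log T_{k,k'},$$ the minimum being over the $K\times K$ doubly stochastic matrices (all row and column sums equal to $1$). This $T=T(\varepsilon)$ is a function of the slots; let $s_T=\frac1K\sum_{k,k'}T_{k,k'}\cos(z^{(q)}_k,z^{(c)}_{k'})$. Write $\Pi^\perp_z(v)=v-\langle z,v\rangle z$, and let $\partial/\partial z^{(q)}_k$ denote the Euclidean gradient in $\mathbb R^D$ with respect to the $k$-th query slot. Set $$G^{\mathrm{dir}}_k=\tfrac1K\Pi^\perp_{z^{(q)}_k}\Bigl(\sum_{k'}T_{k,k'}z^{(c)}_{k'}\Bigr),\qquad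 G^{\mathrm{ind}}_k=\tfrac1K\sum_{j,j'}\frac{\partial T_{j,j'}}{\partial z^{(q)}_k}\cos(z^{(q)}_j,z^{(c)}_{j'}),\qquad G_k=\frac{\partial s_T}{\partial z^{(q)}_k}.$$ Let $\Delta_{\min}=\min_k\bigl(\max_{k'}S_{k,k'}-\text{second-max}_{k'}S_{k,k'}\bigr)$, where the second maximum is counted with multiplicity. **Lemma.** For every $K\ge2$ and every $\delta>0$ there are $\varepsilon_{\mathrm{crit}},C,c>0$, depending only on $K$ and $\delta$, such that the following holds for every $D$. Suppose that $(z^{(q)},z^{(c)})$ satisfies (a) $\Delta_{\min}=\delta>0$ (no ties for the row maxima), and (b) the row-wise greedy assignment $k\mapsto k^*(k)=\arg\max_{k'}S_{k,k'}$ is a permutation of $\{1,\dots,K\}$. Then for all $0<\varepsilon<\varepsilon_{\mathrm{crit}}$ and all $k$: 1. (Concentration) $T_{k,k^*(k)}(\varepsilon)\ge 1-Ce^{-c/\varepsilon}$. 2. (Direct term) $\bigl\|G^{\mathrm{dir}}_k-\tfrac1K\Pi^\perp_{z^{(q)}_k}(z^{(c)}_{k^*(k)})\bigr\|\le Ce^{-c/\varepsilon}$;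 the vector subtracted is the hard-Chamfer gradient. 3. (Indirect term) All entries of $T(\varepsilon)$ are differentiable in $z^{(q)}_k$, $G_k=G^{\mathrm{dir}}_k+G^{\mathrm{ind}}_k$, and $\|G^{\mathrm{ind}}_k\|\le C\varepsilon^{-1}e^{-c/\varepsilon}$; in particular $G^{\mathrm{ind}}_k\to0$ as $\varepsilon\to0^+$. Moreover: 4. (Rank) If $D\ge 2K$, then for every $0<\varepsilon<\varepsilon_{\mathrm{crit}}$ the Jacobian $[G_1,\dots,G_K]^\top\in\mathbb R^{K\times D}$ has rank $K$ generically: for every probability measure $\mu$ on $(\mathcal S^{D-1})^K\times(\mathcal S^{D-1})^K$ that is absolutely continuous with respect to the product of the surface measures, $$\mu\bigl(\{(z^{(q)},z^{(c)}):\ \mathrm{rank}\,[G_1,\dots,G_K]^\top<K\}\bigr)=0 .$$ -/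

import Mathlib

open MeasureTheory Filter Topology

noncomputable section

namespace SlotMatching

/-- Cosine similarity `⟨x, y⟩ / (‖x‖ ‖y‖)`. -/
def cosSim {D : ℕ} (x y : EuclideanSpace ℝ (Fin D)) : ℝ :=
  inner ℝ x y / (‖x‖ * ‖y‖)

/-- The similarity matrix `S k k' = cos (q k, c k')` of query slots `q` and support slots `c`. -/
def simMatrix {K D : ℕ} (q c : Fin K → EuclideanSpace ℝ (Fin D)) : Matrix (Fin K) (Fin K) ℝ :=
  Matrix.of fun k k' => cosSim (q k) (c k')

/-- The largest entry of row `k`. -/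
def rowMax {K : ℕ} (S : Matrix (Fin K) (Fin K) ℝ) (k : Fin K) : ℝ :=
  ⨆ k', S k k'

/-- The second largest entry of row `k`, counted with multiplicity: the smallest value that the
maximum of the row can take after one of its entries is deleted (meaningful for `2 ≤ K`). -/
def rowSecondMax {K : ℕ} (S : Matrix (Fin K) (Fin K) ℝ) (k : Fin K) : ℝ :=
  ⨅ j : Fin K, ⨆ k' : {k' : Fin K // k' ≠ j}, S k k'

/-- The smallest gap, over the rows, between the largest and the second largest entry. -/
def minGap {K : ℕ} (S : Matrix (Fin K) (Fin K) ℝ) : ℝ :=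
  ⨅ k, (rowMax S k - rowSecondMax S k)

/-- `f` picks in every row of `S` the index of a largest entry. -/
def IsRowArgmax {K : ℕ} (S : Matrix (Fin K) (Fin K) ℝ) (f : Fin K → Fin K) : Prop :=
  ∀ k k', S k k' ≤ S k (f k)

/-- The entropy `H(T) = - ∑ T k k' log (T k k')`, with `0 log 0 = 0`. -/
def entropy {K : ℕ} (T : Matrix (Fin K) (Fin K) ℝ) : ℝ :=
  -∑ k, ∑ k', T k k' * Real.log (T k k')

/-- The objective `⟨T, -S⟩ - ε H(T)` of entropic optimal transport. -/
def otObjective {K : ℕ} (ε : ℝ) (S T : Matrix (Fin K) (Fin K) ℝ) : ℝ :=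
  (∑ k, ∑ k', T k k' * (-S k k')) - ε * entropy T

/-- `T` minimizes the entropic optimal transport objective over the doubly stochastic matrices. -/
def IsEntropicCoupling {K : ℕ} (ε : ℝ) (S T : Matrix (Fin K) (Fin K) ℝ) : Prop :=
  T ∈ doublyStochastic ℝ (Fin K) ∧
    ∀ T' ∈ doublyStochastic ℝ (Fin K), otObjective ε S T ≤ otObjective ε S T'

theorem continuous_otObjective {K : ℕ} (ε : ℝ) (S : Matrix (Fin K) (Fin K) ℝ) :
    Continuous (otObjective ε S) := by
  have h : ∀ k k' : Fin K, Continuous fun T : Matrix (Fin K) (Fin K) ℝ => T k k' :=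
    fun k k' => continuous_id.matrix_elem k k'
  unfold otObjective entropy
  refine Continuous.sub ?_ (continuous_const.mul (Continuous.neg ?_))
  · exact continuous_finsetSum _ fun k _ => continuous_finsetSum _ fun k' _ =>
      (h k k').mul continuous_const
  · exact continuous_finsetSum _ fun k _ => continuous_finsetSum _ fun k' _ =>
      Real.continuous_mul_log.comp (h k k')

theorem isCompact_doublyStochastic (K : ℕ) :
    IsCompact (doublyStochastic ℝ (Fin K) : Set (Matrix (Fin K) (Fin K) ℝ)) := by
  have h : ∀ k k' : Fin K, Continuous fun T : Matrix (Fin K) (Fin K) ℝ => T k k' :=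
    fun k k' => continuous_id.matrix_elem k k'
  have hb : IsCompact (Set.pi Set.univ fun _ : Fin K => Set.pi Set.univ fun _ : Fin K =>
      Set.Icc (0 : ℝ) 1) :=
    isCompact_univ_pi fun _ => isCompact_univ_pi fun _ => isCompact_Icc
  refine hb.of_isClosed_subset ?_ ?_
  · have : (doublyStochastic ℝ (Fin K) : Set (Matrix (Fin K) (Fin K) ℝ)) =
        (⋂ i, ⋂ j, {T | 0 ≤ T i j}) ∩ ((⋂ i, {T | ∑ j, T i j = 1}) ∩
          (⋂ j, {T | ∑ i, T i j = 1})) := by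
      ext T
      simp [mem_doublyStochastic_iff_sum]
    rw [this]
    refine IsClosed.inter ?_ (IsClosed.inter ?_ ?_)
    · exact isClosed_iInter fun i => isClosed_iInter fun j => isClosed_le continuous_const (h i j)
    · exact isClosed_iInter fun i =>
        isClosed_eq (continuous_finsetSum _ fun j _ => h i j) continuous_const
    · exact isClosed_iInter fun j =>
        isClosed_eq (continuous_finsetSum _ fun i _ => h i j) continuous_const
  · intro T hT
    obtain ⟨h0, h1, -⟩ := mem_doublyStochastic_iff_sum.1 hT
    intro i _ j _
    refine ⟨h0 i j, ?_⟩
    rw [← h1 i]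
    exact Finset.single_le_sum (f := fun j => T i j) (fun j _ => h0 i j) (Finset.mem_univ j)

theorem exists_isEntropicCoupling {K : ℕ} (ε : ℝ) (S : Matrix (Fin K) (Fin K) ℝ) :
    ∃ T, IsEntropicCoupling ε S T := by
  obtain ⟨T, hT, hmin⟩ := (isCompact_doublyStochastic K).exists_isMinOn
    ⟨1, one_mem _⟩ (continuous_otObjective ε S).continuousOn
  exact ⟨T, hT, fun T' hT' => hmin hT'⟩

/-- For `ε > 0` the minimizer is unique, so that the choice below is the arg min. -/
theorem IsEntropicCoupling.unique {K : ℕ} {ε : ℝ} (hε : 0 < ε) {S T T' : Matrix (Fin K) (Fin K) ℝ}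
    (hT : IsEntropicCoupling ε S T) (hT' : IsEntropicCoupling ε S T') : T = T' := by
  by_contra hne
  obtain ⟨i, j, hij⟩ : ∃ i j, T i j ≠ T' i j := by
    by_contra! h
    exact hne (Matrix.ext h)
  set M : Matrix (Fin K) (Fin K) ℝ := (1 / 2 : ℝ) • T + (1 / 2 : ℝ) • T' with hM
  have hMmem : M ∈ doublyStochastic ℝ (Fin K) :=
    convex_doublyStochastic hT.1 hT'.1 (by norm_num) (by norm_num) (by norm_num)
  have h0 := (mem_doublyStochastic_iff_sum.1 hT.1).1
  have h0' := (mem_doublyStochastic_iff_sum.1 hT'.1).1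
  have hMe : ∀ k k', M k k' = (1 / 2 : ℝ) * T k k' + (1 / 2 : ℝ) * T' k k' := by
    intro k k'
    simp [hM]
  have hle : ∀ k k', M k k' * Real.log (M k k') ≤
      (1 / 2 : ℝ) * (T k k' * Real.log (T k k')) + (1 / 2 : ℝ) * (T' k k' * Real.log (T' k k')) := by
    intro k k'
    rw [hMe]
    exact Real.convexOn_mul_log.2 (h0 k k') (h0' k k') (by norm_num) (by norm_num) (by norm_num)
  have hlt : M i j * Real.log (M i j) <
      (1 / 2 : ℝ) * (T i j * Real.log (T i j)) + (1 / 2 : ℝ) * (T' i j * Real.log (T' i j)) := by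
    rw [hMe]
    exact Real.strictConvexOn_mul_log.2 (h0 i j) (h0' i j) hij (by norm_num) (by norm_num)
      (by norm_num)
  have hsum : ∑ k, ∑ k', M k k' * Real.log (M k k') <
      ∑ k, ∑ k', ((1 / 2 : ℝ) * (T k k' * Real.log (T k k')) +
        (1 / 2 : ℝ) * (T' k k' * Real.log (T' k k'))) :=
    Finset.sum_lt_sum (fun k _ => Finset.sum_le_sum fun k' _ => hle k k')
      ⟨i, Finset.mem_univ _, Finset.sum_lt_sum (fun k' _ => hle i k') ⟨j, Finset.mem_univ _, hlt⟩⟩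
  have hlin : ∑ k, ∑ k', M k k' * (-S k k') =
      (1 / 2 : ℝ) * (∑ k, ∑ k', T k k' * (-S k k')) +
        (1 / 2 : ℝ) * (∑ k, ∑ k', T' k k' * (-S k k')) := by
    simp only [Finset.mul_sum, ← Finset.sum_add_distrib]
    refine Finset.sum_congr rfl fun k _ => Finset.sum_congr rfl fun k' _ => ?_
    rw [hMe]
    ring
  simp only [Finset.sum_add_distrib, ← Finset.mul_sum] at hsum
  have h1 := hT.2 M hMmem
  have h2 := hT'.2 M hMmem
  unfold otObjective entropy at h1 h2
  rw [hlin] at h1 h2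
  nlinarith [mul_lt_mul_of_pos_left hsum hε]

/-- The entropic optimal transport (Sinkhorn) coupling `T(ε)` of the matrix `S`. -/
def sinkhorn {K : ℕ} (ε : ℝ) (S : Matrix (Fin K) (Fin K) ℝ) : Matrix (Fin K) (Fin K) ℝ :=
  (exists_isEntropicCoupling ε S).choose

/-- The coupling of the slot configuration `(q, c)`. -/
def coupling {K D : ℕ} (ε : ℝ) (q c : Fin K → EuclideanSpace ℝ (Fin D)) :
    Matrix (Fin K) (Fin K) ℝ :=
  sinkhorn ε (simMatrix q c)

/-- The assignment score `(1/K) ∑ T k k' cos (q k, c k')` with `T = T(ε)`. -/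
def score {K D : ℕ} (ε : ℝ) (q c : Fin K → EuclideanSpace ℝ (Fin D)) : ℝ :=
  (1 / (K : ℝ)) * ∑ k, ∑ k', coupling ε q c k k' * cosSim (q k) (c k')

/-- For a unit vector `z`, the orthogonal projection `v - ⟨z, v⟩ z` onto the complement of `z`. -/
def perpProj {D : ℕ} (z v : EuclideanSpace ℝ (Fin D)) : EuclideanSpace ℝ (Fin D) :=
  v - (inner ℝ z v) • z

/-- The hard Chamfer gradient with respect to query slot `k`, with matched index `f k`. -/
def hardGrad {K D : ℕ} (q c : Fin K → EuclideanSpace ℝ (Fin D)) (f : Fin K → Fin K) (k : Fin K) :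
    EuclideanSpace ℝ (Fin D) :=
  (1 / (K : ℝ)) • perpProj (q k) (c (f k))

/-- The direct term of the gradient with respect to query slot `k`. -/
def directGrad {K D : ℕ} (ε : ℝ) (q c : Fin K → EuclideanSpace ℝ (Fin D)) (k : Fin K) :
    EuclideanSpace ℝ (Fin D) :=
  (1 / (K : ℝ)) • perpProj (q k) (∑ k', coupling ε q c k k' • c k')

/-- The entry `T j j'` of the coupling as a function of query slot `k` alone. -/
def couplingEntry {K D : ℕ} (ε : ℝ) (q c : Fin K → EuclideanSpace ℝ (Fin D)) (k j j' : Fin K)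
    (w : EuclideanSpace ℝ (Fin D)) : ℝ :=
  coupling ε (Function.update q k w) c j j'

/-- The indirect term `(1/K) ∑ (∂T j j' / ∂(q k)) cos (q j, c j')`; the gradients are
Euclidean gradients in the ambient space (they are tangent to the sphere because the cosine
similarity is invariant under scaling). -/
def indirectGrad {K D : ℕ} (ε : ℝ) (q c : Fin K → EuclideanSpace ℝ (Fin D)) (k : Fin K) :
    EuclideanSpace ℝ (Fin D) :=
  (1 / (K : ℝ)) • ∑ j, ∑ j', cosSim (q j) (c j') • gradient (couplingEntry ε q c k j j') (q k)

/-- The full gradient of the score with respect to query slot `k`. -/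
def fullGrad {K D : ℕ} (ε : ℝ) (q c : Fin K → EuclideanSpace ℝ (Fin D)) (k : Fin K) :
    EuclideanSpace ℝ (Fin D) :=
  gradient (fun w => score ε (Function.update q k w) c) (q k)

/-- The `K × D` matrix whose rows are the full gradients. -/
def jacobian {K D : ℕ} (ε : ℝ) (q c : Fin K → EuclideanSpace ℝ (Fin D)) :
    Matrix (Fin K) (Fin D) ℝ :=
  Matrix.of fun k i => fullGrad ε q c k i

/-- The unit sphere of `ℝ^D`. -/
abbrev Sph (D : ℕ) : Type :=
  Metric.sphere (0 : EuclideanSpace ℝ (Fin D)) 1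

/-- `K` unit slots as vectors of the ambient space. -/
def vecs {K D : ℕ} (z : Fin K → Sph D) : Fin K → EuclideanSpace ℝ (Fin D) :=
  fun k => (z k : EuclideanSpace ℝ (Fin D))

/-- The product of the surface measures on the space `(S^{D-1})^K × (S^{D-1})^K` of
configurations (query slots, support slots). -/
def surfaceMeasure (K D : ℕ) : Measure ((Fin K → Sph D) × (Fin K → Sph D)) :=
  (Measure.pi fun _ : Fin K => (volume : Measure (EuclideanSpace ℝ (Fin D))).toSphere).prod
    (Measure.pi fun _ : Fin K => (volume : Measure (EuclideanSpace ℝ (Fin D))).toSphere)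

end SlotMatching

end

/-! ### First-order optimality for the entropic coupling. -/

noncomputable section

namespace SlotMatching

/-! The minimizer `T` has positive entries, so it is characterized by a stationarity condition: `ε
log T - S` is orthogonal to every balanced matrix. All estimates come from testing this condition,
or its linearization, against a well-chosen balanced matrix.

Concentration: testing with `P_σ - T`, where `P_σ` is the permutation matrix of the greedy
assignment, and using `log x ≤ x - 1`, bounds the mass off the graph of `σ` by `K² e^{-δ/ε}`
(`sum_offMass_le`). The direct term follows at once.

Indirect term: stationarity together with the marginal constraints is an analytic system with
invertible derivative, so `T` is analytic in `S` (`analyticAt_sinkhornFun`). If `X` is the response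
of `T` to a perturbation `Y` of `S`, the linearized condition tested with `X` gives the energy
identity `ε ∑ X²/T = ∑ X Y`. Off the graph of `σ` the entries of `T` are tiny, so a weighted AM-GM
inequality makes `X` tiny there (`sum_off_abs_fderiv_le`), and since `X` is balanced, its entries on
the graph are controlled by the others.

Rank: the Gram determinant of the Jacobian is analytic where all slots are nonzero, so its zeros are
null once it is nonzero at one configuration (`surfaceMeasure_rank_lt_eq_zero`). The argument
integrates along lines through that configuration, almost all of which avoid the zero slots when `D
≥ 2`. The witness has orthonormal tangential components of the matched supports; there the hard
gradients are independent, and the first two estimates show that the true gradients are close to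
them for small `ε` (`gramDet_model_ne_zero`). -/

/-- All row sums and all column sums vanish. -/
def IsBalanced {K : ℕ} (X : Fin K → Fin K → ℝ) : Prop :=
  (∀ i, ∑ j, X i j = 0) ∧ ∀ j, ∑ i, X i j = 0

theorem sinkhorn_spec {K : ℕ} (ε : ℝ) (S : Matrix (Fin K) (Fin K) ℝ) :
    IsEntropicCoupling ε S (sinkhorn ε S) :=
  (exists_isEntropicCoupling ε S).choose_spec

theorem otObjective_eq_sum {K : ℕ} (ε : ℝ) (S T : Matrix (Fin K) (Fin K) ℝ) :
    otObjective ε S T = ∑ i, ∑ j, (ε * (T i j * Real.log (T i j)) - T i j * S i j) := by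
  simp only [otObjective, entropy, Finset.sum_sub_distrib, mul_neg, Finset.sum_neg_distrib,
    Finset.mul_sum]
  ring

/-- The uniform coupling. -/
theorem uniform_mem_doublyStochastic {K : ℕ} (hK : 0 < K) :
    (Matrix.of fun _ _ => 1 / (K : ℝ) : Matrix (Fin K) (Fin K) ℝ) ∈
      doublyStochastic ℝ (Fin K) := by
  have hK' : (K : ℝ) ≠ 0 := by positivity
  rw [mem_doublyStochastic_iff_sum]
  refine ⟨fun i j => ?_, fun i => ?_, fun j => ?_⟩
  · simp
  · simp [hK']
  · simp [hK']

/-- The minimizer has positive entries: the slope of `x log x` at zero is `-∞`. -/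
theorem IsEntropicCoupling.pos {K : ℕ} {ε : ℝ} (hε : 0 < ε) {S T : Matrix (Fin K) (Fin K) ℝ}
    (hT : IsEntropicCoupling ε S T) (i j : Fin K) : 0 < T i j := by
  have hK : 0 < K := i.pos
  have hK' : (0 : ℝ) < K := by exact_mod_cast hK
  have h0 := (mem_doublyStochastic_iff_sum.1 hT.1).1
  by_contra hneg
  have hij : T i j = 0 := le_antisymm (not_lt.1 hneg) (h0 i j)
  set U : Matrix (Fin K) (Fin K) ℝ := Matrix.of fun _ _ => 1 / (K : ℝ) with hU
  have hUmem : U ∈ doublyStochastic ℝ (Fin K) := uniform_mem_doublyStochastic hK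
  set C : ℝ := otObjective ε S U - otObjective ε S T with hC
  -- the entry `(i, j)` gains `ε (t / K) log t` over the convexity bound
  have key : ∀ t : ℝ, 0 < t → t ≤ 1 → 0 ≤ t * C + ε * (t / K) * Real.log t := by
    intro t ht ht1
    set M : Matrix (Fin K) (Fin K) ℝ := (1 - t) • T + t • U with hM
    have hMmem : M ∈ doublyStochastic ℝ (Fin K) :=
      convex_doublyStochastic hT.1 hUmem (by linarith) ht.le (by ring)
    have hMe : ∀ k k', M k k' = (1 - t) * T k k' + t * U k k' := by
      intro k k'
      simp [hM]
    have hle : ∀ k k', ε * (M k k' * Real.log (M k k')) - M k k' * S k k' ≤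
        ((1 - t) * (ε * (T k k' * Real.log (T k k')) - T k k' * S k k') +
        t * (ε * (U k k' * Real.log (U k k')) - U k k' * S k k')) +
          (if k = i ∧ k' = j then ε * (t / K) * Real.log t else 0) := by
      intro k k'
      split_ifs with h
      · obtain ⟨rfl, rfl⟩ := h
        have hUe : U k k' = 1 / K := rfl
        rw [hMe, hij, hUe]
        have : Real.log ((1 - t) * 0 + t * (1 / K)) = Real.log t + Real.log (1 / K) := by
          rw [mul_zero, zero_add, Real.log_mul ht.ne' (by positivity)]
        rw [this]
        apply le_of_eq
        ring
      · have := Real.convexOn_mul_log.2 (h0 k k') (show U k k' ∈ Set.Ici (0 : ℝ) by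
          simp [hU]) (show 0 ≤ 1 - t by linarith) ht.le (by ring)
        simp only [smul_eq_mul, ← hMe] at this
        have h2 := mul_le_mul_of_nonneg_left this hε.le
        rw [hMe] at h2 ⊢
        linarith
    have hsum := Finset.sum_le_sum fun k (_ : k ∈ Finset.univ) =>
      Finset.sum_le_sum fun k' (_ : k' ∈ Finset.univ) => hle k k'
    have hd : ∑ k, ∑ k', (if k = i ∧ k' = j then ε * (t / K) * Real.log t else 0) =
        ε * (t / K) * Real.log t := by
      rw [Finset.sum_eq_single i, Finset.sum_eq_single j]
      · simp
      · intro b _ hb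
        simp [hb]
      · simp
      · intro b _ hb
        simp [hb]
      · simp
    simp only [Finset.sum_add_distrib, ← Finset.mul_sum] at hsum
    rw [hd, ← otObjective_eq_sum, ← otObjective_eq_sum, ← otObjective_eq_sum] at hsum
    have := hT.2 M hMmem
    rw [hC]
    linarith
  -- With this `t`, `C + (ε / K) log t` equals `C - |C| - ε / K < 0`, contradicting `key`.
  have ht : 0 < Real.exp (-(|C| * K / ε) - 1) := Real.exp_pos _
  have h := key _ ht (by
    rw [Real.exp_le_one_iff]
    have : 0 ≤ |C| * K / ε := by positivity
    linarith)
  rw [Real.log_exp] at h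
  have h2 : Real.exp (-(|C| * K / ε) - 1) * C +
      ε * (Real.exp (-(|C| * K / ε) - 1) / K) * (-(|C| * K / ε) - 1) =
      Real.exp (-(|C| * K / ε) - 1) * (C - |C| - ε / K) := by
    field_simp
    ring
  rw [h2] at h
  have h3 : C - |C| - ε / K < 0 := by
    have := le_abs_self C
    have : 0 < ε / K := by positivity
    linarith
  nlinarith

/-- First-order optimality in the balanced directions. -/
theorem IsEntropicCoupling.sum_mul_eq_zero {K : ℕ} {ε : ℝ} (hε : 0 < ε)
    {S T : Matrix (Fin K) (Fin K) ℝ} (hT : IsEntropicCoupling ε S T) {X : Fin K → Fin K → ℝ}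
    (hX : IsBalanced X) : ∑ i, ∑ j, X i j * (ε * Real.log (T i j) - S i j) = 0 := by
  have hpos := hT.pos hε
  set M : ℝ → Matrix (Fin K) (Fin K) ℝ := fun t => Matrix.of fun i j => T i j + t * X i j with hM
  have hcont : ∀ i j, Continuous fun t : ℝ => T i j + t * X i j := fun i j => by fun_prop
  have hev : ∀ᶠ t in 𝓝 (0 : ℝ), ∀ i j, 0 < T i j + t * X i j := by
    rw [eventually_all]
    intro i
    rw [eventually_all]
    intro j
    apply (hcont i j).continuousAt.eventually_const_lt
    simpa using hpos i j
  -- Positivity of `T` makes `T + tX` admissible for small `t` of both signs, so the derivative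
  -- vanishes and is not merely nonnegative.
  have hmin : IsLocalMin (fun t => otObjective ε S (M t)) 0 := by
    filter_upwards [hev] with t ht
    have hM0 : M 0 = T := by
      ext i j
      simp [hM]
    rw [hM0]
    refine hT.2 _ ?_
    obtain ⟨-, h1, h2⟩ := mem_doublyStochastic_iff_sum.1 hT.1
    rw [mem_doublyStochastic_iff_sum]
    refine ⟨fun i j => (ht i j).le, fun i => ?_, fun j => ?_⟩
    · simp [hM, Finset.sum_add_distrib, ← Finset.mul_sum, h1, hX.1]
    · simp [hM, Finset.sum_add_distrib, ← Finset.mul_sum, h2, hX.2]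
  have hder : HasDerivAt (fun t => otObjective ε S (M t))
      (∑ i, ∑ j, (ε * ((Real.log (T i j) + 1) * X i j) - X i j * S i j)) 0 := by
    simp only [otObjective_eq_sum]
    refine HasDerivAt.fun_sum fun i _ => HasDerivAt.fun_sum fun j _ => ?_
    have h1 : HasDerivAt (fun t : ℝ => T i j + t * X i j) (X i j) 0 := by
      simpa using ((hasDerivAt_id (0 : ℝ)).mul_const (X i j)).const_add (T i j)
    have h2 : HasDerivAt (fun t : ℝ => (T i j + t * X i j) * Real.log (T i j + t * X i j))
        ((Real.log (T i j) + 1) * X i j) 0 := by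
      have := Real.hasDerivAt_mul_log (x := T i j + 0 * X i j) (by simpa using (hpos i j).ne')
      have h3 := this.comp (0 : ℝ) h1
      simp only [zero_mul, add_zero] at h3
      exact h3
    exact (h2.const_mul ε).sub (h1.mul_const (S i j))
  have h := hmin.hasDerivAt_eq_zero hder
  -- The summand `1` in the derivative `log x + 1` of `x log x` drops out against a balanced
  -- direction.
  have hbal : ∑ i, ∑ j, ε * X i j = 0 := by
    simp [← Finset.mul_sum, hX.1]
  rw [← h, ← sub_eq_zero, ← Finset.sum_sub_distrib, ← neg_eq_zero, ← hbal,
    ← Finset.sum_neg_distrib]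
  refine Finset.sum_congr rfl fun i _ => ?_
  rw [← Finset.sum_sub_distrib, ← Finset.sum_neg_distrib]
  refine Finset.sum_congr rfl fun j _ => ?_
  ring

/-- The first-order condition characterizes the minimizer among positive couplings. -/
theorem isEntropicCoupling_of_sum_mul_eq_zero {K : ℕ} {ε : ℝ} (hε : 0 < ε)
    {S T : Matrix (Fin K) (Fin K) ℝ} (hT : T ∈ doublyStochastic ℝ (Fin K))
    (hpos : ∀ i j, 0 < T i j)
    (h : ∀ X : Fin K → Fin K → ℝ, IsBalanced X →
      ∑ i, ∑ j, X i j * (ε * Real.log (T i j) - S i j) = 0) :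
    IsEntropicCoupling ε S T := by
  refine ⟨hT, fun T' hT' => ?_⟩
  obtain ⟨-, h1, h2⟩ := mem_doublyStochastic_iff_sum.1 hT
  obtain ⟨h0', h1', h2'⟩ := mem_doublyStochastic_iff_sum.1 hT'
  have hX : IsBalanced fun i j => T' i j - T i j := by
    constructor
    · intro i
      simp [h1, h1']
    · intro j
      simp [h2, h2']
  have hz := h _ hX
  have hconst : ∑ i, ∑ j, ε * (T' i j - T i j) = 0 := by
    simp only [← Finset.mul_sum, hX.1, mul_zero, Finset.sum_const_zero]
  rw [otObjective_eq_sum, otObjective_eq_sum]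
  -- Tangent-line inequality for the convex function `x log x` at `T i j`. After summation the
  -- linear terms vanish, by stationarity and by balance.
  have hle : ∀ i j, (ε * (T i j * Real.log (T i j)) - T i j * S i j) +
      ((T' i j - T i j) * (ε * Real.log (T i j) - S i j) + ε * (T' i j - T i j)) ≤
      ε * (T' i j * Real.log (T' i j)) - T' i j * S i j := by
    intro i j
    have hx := hpos i j
    have hy := h0' i j
    have : T' i j * Real.log (T i j) + (T' i j - T i j) ≤ T' i j * Real.log (T' i j) := by
      rcases hy.eq_or_lt with hy | hy
      · rw [← hy]
        simp [hx.le]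
      · have hl := Real.log_le_sub_one_of_pos (div_pos hx hy)
        rw [Real.log_div hx.ne' hy.ne'] at hl
        have := mul_le_mul_of_nonneg_left hl hy.le
        have e : T' i j * (T i j / T' i j - 1) = T i j - T' i j := by
          field_simp
        rw [e] at this
        linarith
    have := mul_le_mul_of_nonneg_left this hε.le
    linarith
  have := Finset.sum_le_sum fun k (_ : k ∈ Finset.univ) =>
      Finset.sum_le_sum fun k' (_ : k' ∈ Finset.univ) => hle k k'
  simp only [Finset.sum_add_distrib] at this
  rw [hz, hconst] at this
  simpa using this

end SlotMatching

end

/-! ### Analytic dependence of the coupling on the similarity matrix. -/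

open scoped ContDiff
noncomputable section
namespace SlotMatching

variable {K : ℕ}

/-- Double centering: subtract the row means and the column means, add the total mean. -/
def center (K : ℕ) : (Fin K → Fin K → ℝ) →L[ℝ] (Fin K → Fin K → ℝ) :=
  LinearMap.toContinuousLinearMap
    { toFun := fun X i j => X i j - (K : ℝ)⁻¹ * ∑ b, X i b - (K : ℝ)⁻¹ * ∑ a, X a j +
        (K : ℝ)⁻¹ * ((K : ℝ)⁻¹ * ∑ a, ∑ b, X a b)
      map_add' := fun X Y => by
        ext i j
        simp only [Pi.add_apply, Finset.sum_add_distrib]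
        ring
      map_smul' := fun r X => by
        ext i j
        simp only [Pi.smul_apply, smul_eq_mul, ← Finset.mul_sum, RingHom.id_apply]
        ring }

theorem center_apply (X : Fin K → Fin K → ℝ) (i j : Fin K) :
    center K X i j = X i j - (K : ℝ)⁻¹ * ∑ b, X i b - (K : ℝ)⁻¹ * ∑ a, X a j +
        (K : ℝ)⁻¹ * ((K : ℝ)⁻¹ * ∑ a, ∑ b, X a b) := rfl

theorem isBalanced_center (X : Fin K → Fin K → ℝ) : IsBalanced (center K X) := by
  constructor
  · intro i
    have hK : (K : ℝ) ≠ 0 := by exact_mod_cast i.pos.ne'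
    simp only [center_apply, Finset.sum_add_distrib, Finset.sum_sub_distrib, Finset.sum_const,
      Finset.card_univ, Fintype.card_fin, nsmul_eq_mul, ← Finset.mul_sum]
    rw [Finset.sum_comm (f := fun a b => X b a)]
    field_simp
    ring
  · intro j
    have hK : (K : ℝ) ≠ 0 := by exact_mod_cast j.pos.ne'
    simp only [center_apply, Finset.sum_add_distrib, Finset.sum_sub_distrib, Finset.sum_const,
      Finset.card_univ, Fintype.card_fin, nsmul_eq_mul, ← Finset.mul_sum]
    field_simp
    ring

theorem IsBalanced.center_eq {X : Fin K → Fin K → ℝ} (hX : IsBalanced X) : center K X = X := by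
  ext i j
  simp [center_apply, hX.1, hX.2]

/-- The corrections made by `center` depend on only one index or on none, hence are orthogonal to
balanced matrices: `center` is the orthogonal projection onto them. -/
theorem IsBalanced.sum_mul_center {Z : Fin K → Fin K → ℝ} (hZ : IsBalanced Z)
    (X : Fin K → Fin K → ℝ) :
    ∑ i, ∑ j, Z i j * center K X i j = ∑ i, ∑ j, Z i j * X i j := by
  have e1 : ∑ i, ∑ j, Z i j * ((K : ℝ)⁻¹ * ∑ b, X i b) = 0 := by
    simp [← Finset.sum_mul, hZ.1]
  have e2 : ∑ i, ∑ j, Z i j * ((K : ℝ)⁻¹ * ∑ a, X a j) = 0 := by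
    rw [Finset.sum_comm]
    simp [← Finset.sum_mul, hZ.2]
  have e3 : ∑ i, ∑ j, Z i j * ((K : ℝ)⁻¹ * ((K : ℝ)⁻¹ * ∑ a, ∑ b, X a b)) = 0 := by
    simp [← Finset.sum_mul, hZ.1]
  simp only [center_apply, mul_add, mul_sub, Finset.sum_add_distrib, Finset.sum_sub_distrib,
    e1, e2, e3]
  ring

/-- Testing with `Z = center K Y` yields the sum of the squares of its entries. -/
theorem center_eq_zero_of_forall {Y : Fin K → Fin K → ℝ}
    (h : ∀ Z : Fin K → Fin K → ℝ, IsBalanced Z → ∑ i, ∑ j, Z i j * Y i j = 0) :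
    center K Y = 0 := by
  have hZ := isBalanced_center Y
  have h1 := h _ hZ
  rw [← hZ.sum_mul_center Y] at h1
  ext i j
  have h2 := (Finset.sum_eq_zero_iff_of_nonneg fun i _ => Finset.sum_nonneg fun j _ =>
    mul_self_nonneg (center K Y i j)).1 h1 i (Finset.mem_univ i)
  have h3 := (Finset.sum_eq_zero_iff_of_nonneg fun j _ =>
    mul_self_nonneg (center K Y i j)).1 h2 j (Finset.mem_univ j)
  simpa using h3

theorem center_center (X : Fin K → Fin K → ℝ) : center K (center K X) = center K X :=
  (isBalanced_center X).center_eq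

theorem center_const (r : ℝ) : center K (fun _ _ => r) = 0 :=
  center_eq_zero_of_forall fun Z hZ => by simp [← Finset.sum_mul, hZ.1]

/-- This and the converse below encode the marginal constraints as one linear equation in the
complement of the balanced matrices, so that they can be added to the stationarity equation without
loss. -/
theorem sub_center_of_mem_doublyStochastic {T : Matrix (Fin K) (Fin K) ℝ}
    (hT : T ∈ doublyStochastic ℝ (Fin K)) :
    (fun i j => T i j) - center K (fun i j => T i j) = fun _ _ => (K : ℝ)⁻¹ := by
  obtain ⟨-, h1, h2⟩ := mem_doublyStochastic_iff_sum.1 hT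
  ext i j
  have hK : (K : ℝ) ≠ 0 := by exact_mod_cast i.pos.ne'
  simp only [Pi.sub_apply, center_apply, h1, h2, Finset.sum_const, Finset.card_univ,
    Fintype.card_fin, nsmul_eq_mul]
  field_simp
  ring

theorem mem_doublyStochastic_of_sub_center {T : Fin K → Fin K → ℝ} (h0 : ∀ i j, 0 ≤ T i j)
    (hT : T - center K T = fun _ _ => (K : ℝ)⁻¹) :
    Matrix.of T ∈ doublyStochastic ℝ (Fin K) := by
  have hb := isBalanced_center T
  have he : ∀ i j, T i j = center K T i j + (K : ℝ)⁻¹ := fun i j => by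
    rw [← congrFun (congrFun hT i) j]
    simp
  rw [mem_doublyStochastic_iff_sum]
  refine ⟨h0, fun i => ?_, fun j => ?_⟩
  · have hK : (K : ℝ) ≠ 0 := by exact_mod_cast i.pos.ne'
    calc ∑ j, T i j = ∑ j, (center K T i j + (K : ℝ)⁻¹) := Finset.sum_congr rfl fun j _ => he i j
      _ = 1 := by simp [Finset.sum_add_distrib, hb.1, hK]
  · have hK : (K : ℝ) ≠ 0 := by exact_mod_cast j.pos.ne'
    calc ∑ i, T i j = ∑ i, (center K T i j + (K : ℝ)⁻¹) := Finset.sum_congr rfl fun i _ => he i j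
      _ = 1 := by simp [Finset.sum_add_distrib, hb.2, hK]

/-- The optimality system: on couplings, the centered part of `ε log T` must be that of `S`. -/
def optimalityMap (ε : ℝ) (T : Fin K → Fin K → ℝ) : Fin K → Fin K → ℝ :=
  center K (fun i j => ε * Real.log (T i j)) + (T - center K T)

/-- The derivative of the optimality system. -/
def optimalityDeriv (ε : ℝ) (T : Fin K → Fin K → ℝ) :
    (Fin K → Fin K → ℝ) →L[ℝ] (Fin K → Fin K → ℝ) :=
  (center K).comp (ContinuousLinearMap.pi fun i => ContinuousLinearMap.pi fun j =>
    ε • (T i j)⁻¹ • (ContinuousLinearMap.proj j).comp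
      (ContinuousLinearMap.proj (R := ℝ) (φ := fun _ : Fin K => Fin K → ℝ) i)) +
    (ContinuousLinearMap.id ℝ _ - center K)

theorem optimalityDeriv_apply (ε : ℝ) (T X : Fin K → Fin K → ℝ) :
    optimalityDeriv ε T X = center K (fun i j => ε * ((T i j)⁻¹ * X i j)) + (X - center K X) :=
  rfl

theorem hasFDerivAt_optimalityMap (ε : ℝ) {T : Fin K → Fin K → ℝ} (hT : ∀ i j, 0 < T i j) :
    HasFDerivAt (optimalityMap ε) (optimalityDeriv ε T) T := by
  refine HasFDerivAt.add ?_ ((hasFDerivAt_id T).sub (center K).hasFDerivAt)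
  refine (center K).hasFDerivAt.comp T ?_
  rw [hasFDerivAt_pi]
  intro i
  rw [hasFDerivAt_pi]
  intro j
  have h1 : HasFDerivAt (fun T : Fin K → Fin K → ℝ => T i j)
      ((ContinuousLinearMap.proj j).comp
        (ContinuousLinearMap.proj (R := ℝ) (φ := fun _ : Fin K => Fin K → ℝ) i)) T :=
    ((ContinuousLinearMap.proj j).comp
        (ContinuousLinearMap.proj (R := ℝ) (φ := fun _ : Fin K => Fin K → ℝ) i)).hasFDerivAt
  exact (h1.log (hT i j).ne').const_mul ε

theorem contDiffAt_optimalityMap (ε : ℝ) {T : Fin K → Fin K → ℝ} (hT : ∀ i j, 0 < T i j) :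
    ContDiffAt ℝ ω (optimalityMap ε) T := by
  refine ContDiffAt.add ?_ (contDiffAt_id.sub (center K).contDiff.contDiffAt)
  refine (center K).contDiff.contDiffAt.comp T ?_
  rw [contDiffAt_pi]
  intro i
  rw [contDiffAt_pi]
  intro j
  have h1 : ContDiffAt ℝ ω (fun T : Fin K → Fin K → ℝ => T i j) T :=
    ((ContinuousLinearMap.proj j).comp
        (ContinuousLinearMap.proj (R := ℝ) (φ := fun _ : Fin K => Fin K → ℝ) i)).contDiff.contDiffAt
  exact contDiffAt_const.mul (h1.log (hT i j).ne')

/-- For `X` in the kernel, the component complementary to the balanced matrices shows that `X` is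
balanced; pairing the balanced component with `X` then gives `ε ∑ X²/T = 0`. -/
theorem optimalityDeriv_injective {ε : ℝ} (hε : 0 < ε) {T : Fin K → Fin K → ℝ}
    (hT : ∀ i j, 0 < T i j) : Function.Injective (optimalityDeriv ε T) := by
  rw [injective_iff_map_eq_zero]
  intro X hX
  rw [optimalityDeriv_apply] at hX
  have h1 : center K (fun i j => ε * ((T i j)⁻¹ * X i j)) = 0 := by
    have := congrArg (center K) hX
    simpa [center_center] using this
  have h2 : center K X = X := by
    rw [h1, zero_add, sub_eq_zero] at hX
    exact hX.symm
  have hb : IsBalanced X := h2 ▸ isBalanced_center X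
  have h3 := hb.sum_mul_center (fun i j => ε * ((T i j)⁻¹ * X i j))
  rw [h1] at h3
  simp only [Pi.zero_apply, mul_zero, Finset.sum_const_zero] at h3
  have hnn : ∀ i j, 0 ≤ X i j * (ε * ((T i j)⁻¹ * X i j)) := fun i j => by
    have := hT i j
    have : X i j * (ε * ((T i j)⁻¹ * X i j)) = ε * (T i j)⁻¹ * (X i j * X i j) := by ring
    rw [this]
    have := mul_self_nonneg (X i j)
    positivity
  ext i j
  have h4 := (Finset.sum_eq_zero_iff_of_nonneg fun i _ => Finset.sum_nonneg fun j _ =>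
    hnn i j).1 h3.symm i (Finset.mem_univ i)
  have h5 := (Finset.sum_eq_zero_iff_of_nonneg fun j _ => hnn i j).1 h4 j (Finset.mem_univ j)
  have := (hT i j).ne'
  simpa [hε.ne', this] using h5

/-- The Sinkhorn coupling as a map between spaces of functions of two variables. -/
def sinkhornFun (ε : ℝ) (s : Fin K → Fin K → ℝ) : Fin K → Fin K → ℝ :=
  fun i j => sinkhorn ε (Matrix.of s) i j

theorem optimalityMap_sinkhornFun {ε : ℝ} (hε : 0 < ε) (S : Fin K → Fin K → ℝ) :
    optimalityMap ε (sinkhornFun ε S) = center K S + fun _ _ => (K : ℝ)⁻¹ := by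
  have hT := sinkhorn_spec ε (Matrix.of S)
  have h := center_eq_zero_of_forall (K := K)
    (Y := (fun i j => ε * Real.log (sinkhorn ε (Matrix.of S) i j)) - S)
    fun Z hZ => hT.sum_mul_eq_zero hε hZ
  rw [map_sub, sub_eq_zero] at h
  change center K (fun i j => ε * Real.log (sinkhorn ε (Matrix.of S) i j)) + _ = _
  rw [h]
  congr 1
  exact sub_center_of_mem_doublyStochastic hT.1

/-- Applying `center` splits the equation into stationarity and the marginal constraints. These
suffice for a positive matrix to be a minimizer, and the minimizer is unique. -/
theorem eq_sinkhornFun_of_optimalityMap {ε : ℝ} (hε : 0 < ε) {S T : Fin K → Fin K → ℝ}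
    (hT : ∀ i j, 0 < T i j) (h : optimalityMap ε T = center K S + fun _ _ => (K : ℝ)⁻¹) :
    T = sinkhornFun ε S := by
  have h1 : center K (fun i j => ε * Real.log (T i j)) = center K S := by
    have := congrArg (center K) h
    simpa [optimalityMap, center_center, center_const] using this
  have h2 : T - center K T = fun _ _ => (K : ℝ)⁻¹ := by
    rw [optimalityMap, h1] at h
    exact add_left_cancel h
  have h3 : IsEntropicCoupling ε (Matrix.of S) (Matrix.of T) := by
    refine isEntropicCoupling_of_sum_mul_eq_zero hε
      (mem_doublyStochastic_of_sub_center (fun i j => (hT i j).le) h2) hT fun X hX => ?_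
    have h4 := hX.sum_mul_center ((fun i j => ε * Real.log (T i j)) - S)
    rw [map_sub, h1, sub_self] at h4
    simpa using h4.symm
  ext i j
  exact congrFun (congrFun (h3.unique hε (sinkhorn_spec ε (Matrix.of S))) i) j

/-- The Sinkhorn coupling is an analytic function of the similarity matrix. -/
theorem analyticAt_sinkhornFun {ε : ℝ} (hε : 0 < ε) (S : Fin K → Fin K → ℝ) :
    AnalyticAt ℝ (sinkhornFun ε) S := by
  set T : Fin K → Fin K → ℝ := sinkhornFun ε S with hTdef
  have hT : ∀ i j, 0 < T i j := (sinkhorn_spec ε (Matrix.of S)).pos hε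
  -- In finite dimension injectivity gives invertibility, as the inverse function theorem requires.
  set e : (Fin K → Fin K → ℝ) ≃L[ℝ] (Fin K → Fin K → ℝ) :=
    (LinearEquiv.ofInjectiveEndo (optimalityDeriv ε T).toLinearMap
      (optimalityDeriv_injective hε hT)).toContinuousLinearEquiv
  have hc := contDiffAt_optimalityMap ε hT
  have hd : HasFDerivAt (optimalityMap ε) (e : (Fin K → Fin K → ℝ) →L[ℝ] _) T := by
    exact hasFDerivAt_optimalityMap ε hT
  have hn : (ω : WithTop ℕ∞) ≠ 0 := by simp
  have hs := hc.hasStrictFDerivAt' hd hn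
  have hinv : ContDiffAt ℝ ω (hs.localInverse (optimalityMap ε) e T) (optimalityMap ε T) :=
    hc.to_localInverse hd hn
  set A : (Fin K → Fin K → ℝ) → (Fin K → Fin K → ℝ) := fun s => center K s + fun _ _ => (K : ℝ)⁻¹
  have hA : ContDiff ℝ ω A := (center K).contDiff.add contDiff_const
  have hAS : A S = optimalityMap ε T := (optimalityMap_sinkhornFun hε S).symm
  have hAt : Tendsto A (𝓝 S) (𝓝 (optimalityMap ε T)) := hAS ▸ hA.continuous.tendsto S
  have hcomp : ContDiffAt ℝ ω (hs.localInverse (optimalityMap ε) e T ∘ A) S :=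
    ContDiffAt.comp S (by rwa [hAS]) hA.contDiffAt
  refine hcomp.analyticAt.congr ?_
  -- The local inverse stays positive near the base point, so it solves the optimality system among
  -- positive matrices and must be the Sinkhorn coupling.
  have hposT : ∀ᶠ T' in 𝓝 T, ∀ i j, 0 < T' i j := by
    rw [eventually_all]
    intro i
    rw [eventually_all]
    intro j
    exact (show Continuous fun T' : Fin K → Fin K → ℝ => T' i j by fun_prop).continuousAt
      |>.eventually_const_lt (hT i j)
  filter_upwards [hAt.eventually hs.eventually_right_inverse,
    hAt.eventually (hs.localInverse_tendsto.eventually hposT)] with s h1 h2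
  exact eq_sinkhornFun_of_optimalityMap hε h2 h1

end SlotMatching
end

/-! ### Concentration of the coupling and decay of its response. -/

noncomputable section
namespace SlotMatching

variable {K : ℕ}

theorem sinkhornFun_pos {ε : ℝ} (hε : 0 < ε) (S : Fin K → Fin K → ℝ) (i j : Fin K) :
    0 < sinkhornFun ε S i j :=
  (sinkhorn_spec ε (Matrix.of S)).pos hε i j

theorem sum_row_sinkhornFun (ε : ℝ) (S : Fin K → Fin K → ℝ) (i : Fin K) :
    ∑ j, sinkhornFun ε S i j = 1 :=
  (mem_doublyStochastic_iff_sum.1 (sinkhorn_spec ε (Matrix.of S)).1).2.1 i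

theorem sum_col_sinkhornFun (ε : ℝ) (S : Fin K → Fin K → ℝ) (j : Fin K) :
    ∑ i, sinkhornFun ε S i j = 1 :=
  (mem_doublyStochastic_iff_sum.1 (sinkhorn_spec ε (Matrix.of S)).1).2.2 j

theorem sum_mul_sinkhornFun_eq_zero {ε : ℝ} (hε : 0 < ε) (S : Fin K → Fin K → ℝ)
    {Z : Fin K → Fin K → ℝ} (hZ : IsBalanced Z) :
    ∑ i, ∑ j, Z i j * (ε * Real.log (sinkhornFun ε S i j) - S i j) = 0 :=
  (sinkhorn_spec ε (Matrix.of S)).sum_mul_eq_zero hε hZ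

theorem hasDerivAt_sinkhornFun {ε : ℝ} (hε : 0 < ε) (S Y : Fin K → Fin K → ℝ) (i j : Fin K) :
    HasDerivAt (fun t : ℝ => sinkhornFun ε (S + t • Y) i j)
      (fderiv ℝ (sinkhornFun ε) S Y i j) 0 := by
  have h := (analyticAt_sinkhornFun hε S).differentiableAt.hasFDerivAt
  have h0 : S = S + (0 : ℝ) • Y := by simp
  have hl : HasDerivAt (fun t : ℝ => S + t • Y) Y 0 := by
    simpa using ((hasDerivAt_id (0 : ℝ)).smul_const Y).const_add S
  have h1 := HasFDerivAt.comp_hasDerivAt_of_eq (0 : ℝ) h hl h0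
  exact hasDerivAt_pi.1 (hasDerivAt_pi.1 h1 i) j

/-- The row and column sums of the coupling are constantly `1`, so their derivatives vanish. -/
theorem isBalanced_fderiv_sinkhornFun {ε : ℝ} (hε : 0 < ε) (S Y : Fin K → Fin K → ℝ) :
    IsBalanced (fderiv ℝ (sinkhornFun ε) S Y) := by
  constructor
  · intro i
    have h := HasDerivAt.fun_sum fun j (_ : j ∈ Finset.univ) => hasDerivAt_sinkhornFun hε S Y i j
    simp only [sum_row_sinkhornFun] at h
    exact h.unique (hasDerivAt_const (0 : ℝ) (1 : ℝ))
  · intro j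
    have h := HasDerivAt.fun_sum fun i (_ : i ∈ Finset.univ) => hasDerivAt_sinkhornFun hε S Y i j
    simp only [sum_col_sinkhornFun] at h
    exact h.unique (hasDerivAt_const (0 : ℝ) (1 : ℝ))

/-- The linearized optimality condition. -/
theorem sum_mul_fderiv_sinkhornFun {ε : ℝ} (hε : 0 < ε) (S Y : Fin K → Fin K → ℝ)
    {Z : Fin K → Fin K → ℝ} (hZ : IsBalanced Z) :
    ∑ i, ∑ j, Z i j * (ε * (fderiv ℝ (sinkhornFun ε) S Y i j / sinkhornFun ε S i j)) =
      ∑ i, ∑ j, Z i j * Y i j := by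
  have h : HasDerivAt (fun t : ℝ => ∑ i, ∑ j, Z i j *
      (ε * Real.log (sinkhornFun ε (S + t • Y) i j) - (S + t • Y) i j))
      (∑ i, ∑ j, Z i j *
        (ε * (fderiv ℝ (sinkhornFun ε) S Y i j / sinkhornFun ε S i j) - Y i j)) 0 := by
    refine HasDerivAt.fun_sum fun i _ => HasDerivAt.fun_sum fun j _ => ?_
    refine HasDerivAt.const_mul _ (HasDerivAt.sub (HasDerivAt.const_mul _ ?_) ?_)
    · have := (hasDerivAt_sinkhornFun hε S Y i j).log (sinkhornFun_pos hε _ i j).ne'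
      simpa only [zero_smul, add_zero] using this
    · have := ((hasDerivAt_id (0 : ℝ)).mul_const (Y i j)).const_add (S i j)
      simpa using this
  simp only [sum_mul_sinkhornFun_eq_zero hε _ hZ] at h
  have h0 := h.unique (hasDerivAt_const (0 : ℝ) (0 : ℝ))
  simp only [mul_sub, Finset.sum_sub_distrib] at h0
  linarith

theorem sinkhornFun_le_one {ε : ℝ} (hε : 0 < ε) (S : Fin K → Fin K → ℝ) (i j : Fin K) :
    sinkhornFun ε S i j ≤ 1 := by
  rw [← sum_row_sinkhornFun ε S i]
  exact Finset.single_le_sum (f := fun j => sinkhornFun ε S i j)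
    (fun j _ => (sinkhornFun_pos hε S i j).le) (Finset.mem_univ j)

theorem sum_erase_sinkhornFun (ε : ℝ) (S : Fin K → Fin K → ℝ) (i a : Fin K) :
    ∑ j ∈ Finset.univ.erase a, sinkhornFun ε S i j = 1 - sinkhornFun ε S i a := by
  rw [← sum_row_sinkhornFun ε S i, ← Finset.add_sum_erase _ _ (Finset.mem_univ a)]
  ring

/-- If a permutation `σ` picks the row maxima with margin `δ`, the mass of the coupling outside
the graph of `σ` is exponentially small. -/
theorem sum_offMass_le {ε δ : ℝ} (hε : 0 < ε) {S : Fin K → Fin K → ℝ} {σ : Fin K → Fin K}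
    (hσ : Function.Bijective σ) (hgap : ∀ i j, j ≠ σ i → S i j + δ ≤ S i (σ i)) :
    ∑ i, ∑ j ∈ Finset.univ.erase (σ i), sinkhornFun ε S i j ≤
      (K : ℝ) ^ 2 * Real.exp (-δ / ε) := by
  set T := sinkhornFun ε S with hTdef
  -- The test direction is `P_σ - T`, a difference of two doubly stochastic matrices; this is where
  -- bijectivity of `σ` enters.
  have hZ : IsBalanced fun i j => (if j = σ i then (1 : ℝ) else 0) - T i j := by
    constructor
    · intro i
      simp [hTdef, sum_row_sinkhornFun]
    · intro j
      obtain ⟨a, rfl⟩ := hσ.2 j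
      have : ∀ i, (σ a = σ i) = (a = i) := fun i => by rw [hσ.1.eq_iff]
      simp [hTdef, sum_col_sinkhornFun, this]
  have h := sum_mul_sinkhornFun_eq_zero hε S hZ
  rw [← hTdef] at h
  have hrow : ∀ i, ∑ j, ((if j = σ i then (1 : ℝ) else 0) - T i j) *
      (ε * Real.log (T i j) - S i j) ≤
      ∑ j ∈ Finset.univ.erase (σ i), ε * (Real.exp (-δ / ε) - T i j) := by
    intro i
    rw [← Finset.add_sum_erase _ _ (Finset.mem_univ (σ i))]
    have e1 : ∑ j ∈ Finset.univ.erase (σ i), ((if j = σ i then (1 : ℝ) else 0) - T i j) *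
        (ε * Real.log (T i j) - S i j) =
        ∑ j ∈ Finset.univ.erase (σ i), -T i j * (ε * Real.log (T i j) - S i j) := by
      refine Finset.sum_congr rfl fun j hj => ?_
      simp [Finset.ne_of_mem_erase hj]
    -- The coefficient `1 - T i (σ i)` of the matched entry is the mass of the rest of the row, so
    -- its contribution can be distributed over the unmatched entries and each of these estimated
    -- separately.
    rw [e1, if_pos rfl, ← sum_erase_sinkhornFun, ← hTdef, Finset.sum_mul,
      ← Finset.sum_add_distrib]
    refine Finset.sum_le_sum fun j hj => ?_
    have hg := hgap i j (Finset.ne_of_mem_erase hj)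
    have ht : 0 < T i j := sinkhornFun_pos hε S i j
    have hl : Real.log (T i (σ i)) ≤ 0 :=
      Real.log_nonpos (sinkhornFun_pos hε S _ _).le (sinkhornFun_le_one hε S _ _)
    -- Taking `x = e^{-δ/ε} / T i j` in `log x ≤ x - 1` bounds `T (-δ - ε log T)` by `ε (e^{-δ/ε} -
    -- T)`.
    have h1 := Real.log_le_sub_one_of_pos (div_pos (Real.exp_pos (-δ / ε)) ht)
    rw [Real.log_div (Real.exp_pos _).ne' ht.ne', Real.log_exp] at h1
    have h2 := mul_le_mul_of_nonneg_left h1 (mul_pos hε ht).le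
    have h3 : ε * T i j * (Real.exp (-δ / ε) / T i j - 1) =
        ε * (Real.exp (-δ / ε) - T i j) := by
      field_simp
    have h4 : ε * T i j * (-δ / ε - Real.log (T i j)) =
        T i j * (-δ - ε * Real.log (T i j)) := by
      field_simp
    rw [h3, h4] at h2
    have h5 : ε * Real.log (T i (σ i)) ≤ 0 := mul_nonpos_of_nonneg_of_nonpos hε.le hl
    have h6 : T i j * (ε * Real.log (T i (σ i)) - S i (σ i) + S i j + δ) ≤ 0 :=
      mul_nonpos_of_nonneg_of_nonpos ht.le (by linarith)
    linarith
  have hs := Finset.sum_le_sum fun i (_ : i ∈ Finset.univ) => hrow i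
  rw [h] at hs
  simp only [← Finset.mul_sum, Finset.sum_sub_distrib] at hs
  have hs' := nonneg_of_mul_nonneg_right hs hε
  have hcard : ∑ i, ∑ _j ∈ Finset.univ.erase (σ i), Real.exp (-δ / ε) ≤
      (K : ℝ) ^ 2 * Real.exp (-δ / ε) := by
    calc ∑ i, ∑ _j ∈ Finset.univ.erase (σ i), Real.exp (-δ / ε)
        ≤ ∑ _i : Fin K, ∑ _j : Fin K, Real.exp (-δ / ε) :=
          Finset.sum_le_sum fun i _ => Finset.sum_le_sum_of_subset_of_nonneg
            (Finset.erase_subset _ _) fun _ _ _ => (Real.exp_pos _).le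
      _ = (K : ℝ) ^ 2 * Real.exp (-δ / ε) := by
          simp only [Finset.sum_const, Finset.card_univ, Fintype.card_fin, nsmul_eq_mul]
          ring
  linarith

theorem one_sub_sinkhornFun_le {ε δ : ℝ} (hε : 0 < ε) {S : Fin K → Fin K → ℝ} {σ : Fin K → Fin K}
    (hσ : Function.Bijective σ) (hgap : ∀ i j, j ≠ σ i → S i j + δ ≤ S i (σ i)) (k : Fin K) :
    1 - sinkhornFun ε S k (σ k) ≤ (K : ℝ) ^ 2 * Real.exp (-δ / ε) := by
  refine le_trans ?_ (sum_offMass_le hε hσ hgap)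
  rw [← sum_erase_sinkhornFun]
  exact Finset.single_le_sum
    (f := fun i => ∑ j ∈ Finset.univ.erase (σ i), sinkhornFun ε S i j)
    (fun i _ => Finset.sum_nonneg fun j _ => (sinkhornFun_pos hε S i j).le) (Finset.mem_univ k)

/-- A pairing with a balanced matrix is controlled by the entries off the graph of `σ`. -/
theorem IsBalanced.abs_sum_mul_le {X : Fin K → Fin K → ℝ} (hX : IsBalanced X)
    {Y : Fin K → Fin K → ℝ} {b : ℝ} (hY : ∀ i j, |Y i j| ≤ b) (σ : Fin K → Fin K) :
    |∑ i, ∑ j, X i j * Y i j| ≤ 2 * b * ∑ i, ∑ j ∈ Finset.univ.erase (σ i), |X i j| := by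
  rw [Finset.mul_sum]
  refine (Finset.abs_sum_le_sum_abs _ _).trans (Finset.sum_le_sum fun i _ => ?_)
  have hb : 0 ≤ b := (abs_nonneg _).trans (hY i i)
  have h1 := hX.1 i
  rw [← Finset.add_sum_erase _ _ (Finset.mem_univ (σ i))] at h1 ⊢
  -- The row sum is zero, so the matched entry is minus the sum of the others.
  have h2 : |X i (σ i)| ≤ ∑ j ∈ Finset.univ.erase (σ i), |X i j| := by
    rw [eq_neg_of_add_eq_zero_left h1, abs_neg]
    exact Finset.abs_sum_le_sum_abs _ _
  have h3 : |∑ j ∈ Finset.univ.erase (σ i), X i j * Y i j| ≤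
      b * ∑ j ∈ Finset.univ.erase (σ i), |X i j| := by
    rw [Finset.mul_sum]
    refine (Finset.abs_sum_le_sum_abs _ _).trans (Finset.sum_le_sum fun j _ => ?_)
    rw [abs_mul, mul_comm]
    exact mul_le_mul_of_nonneg_right (hY i j) (abs_nonneg _)
  have h4 : |X i (σ i) * Y i (σ i)| ≤ b * ∑ j ∈ Finset.univ.erase (σ i), |X i j| := by
    rw [abs_mul, mul_comm]
    exact mul_le_mul (hY _ _) h2 (abs_nonneg _) hb
  refine (abs_add_le _ _).trans ?_
  linarith

/-- Let `A` be the left side and `m` the off-graph mass of `T`. The energy identity gives `ε ∑ X²/T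
≤ 2bA`, while AM-GM gives `2A ≤ (2b/ε) m + (2b)⁻¹ ε ∑ X²/T`, with sums off the graph. Hence `A ≤
(2b/ε) m`. -/
theorem sum_off_abs_fderiv_le {ε δ : ℝ} (hε : 0 < ε) {S : Fin K → Fin K → ℝ} {σ : Fin K → Fin K}
    (hσ : Function.Bijective σ) (hgap : ∀ i j, j ≠ σ i → S i j + δ ≤ S i (σ i))
    {Y : Fin K → Fin K → ℝ} {b : ℝ} (hb : 0 < b) (hY : ∀ i j, |Y i j| ≤ b) :
    ∑ i, ∑ j ∈ Finset.univ.erase (σ i), |fderiv ℝ (sinkhornFun ε) S Y i j| ≤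
      2 * b * ((K : ℝ) ^ 2 * (ε⁻¹ * Real.exp (-δ / ε))) := by
  set T := sinkhornFun ε S with hTdef
  set X := fderiv ℝ (sinkhornFun ε) S Y with hXdef
  have hX : IsBalanced X := isBalanced_fderiv_sinkhornFun hε S Y
  have hmass := sum_offMass_le hε hσ hgap
  rw [← hTdef] at hmass
  set m := ∑ i, ∑ j ∈ Finset.univ.erase (σ i), T i j
  set A := ∑ i, ∑ j ∈ Finset.univ.erase (σ i), |X i j| with hA
  have hpos : ∀ i j, 0 < T i j := sinkhornFun_pos hε S
  have hE := sum_mul_fderiv_sinkhornFun hε S Y hX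
  rw [← hTdef, ← hXdef] at hE
  have hle : ∑ i, ∑ j ∈ Finset.univ.erase (σ i), X i j * (ε * (X i j / T i j)) ≤ 2 * b * A := by
    refine le_trans ?_ ((le_abs_self _).trans (hX.abs_sum_mul_le hY σ))
    rw [← hE]
    refine Finset.sum_le_sum fun i _ => Finset.sum_le_sum_of_subset_of_nonneg
      (Finset.erase_subset _ _) fun j _ _ => ?_
    have h1 : X i j * (ε * (X i j / T i j)) = ε * (X i j * X i j / T i j) := by ring
    rw [h1]
    exact mul_nonneg hε.le (div_nonneg (mul_self_nonneg _) (hpos i j).le)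
  -- The weights are chosen so that the energy term sums to at most `A`, which is absorbed on the
  -- left. The difference of the two sides is a multiple of a square.
  have hpt : ∀ i j, 2 * |X i j| ≤
      2 * b / ε * T i j + (2 * b)⁻¹ * (X i j * (ε * (X i j / T i j))) := by
    intro i j
    have ht := hpos i j
    have h1 : 2 * b / ε * T i j + (2 * b)⁻¹ * (X i j * (ε * (X i j / T i j))) - 2 * |X i j| =
        ε / (2 * b * T i j) * (2 * b / ε * T i j - |X i j|) ^ 2 := by
      have : X i j * (ε * (X i j / T i j)) = ε * (|X i j| ^ 2 / T i j) := by
        rw [sq_abs]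
        ring
      rw [this]
      field_simp
      ring
    have : 0 ≤ ε / (2 * b * T i j) * (2 * b / ε * T i j - |X i j|) ^ 2 := by positivity
    linarith
  have hsum := Finset.sum_le_sum fun i (_ : i ∈ Finset.univ) =>
    Finset.sum_le_sum fun j (_ : j ∈ Finset.univ.erase (σ i)) => hpt i j
  simp only [Finset.sum_add_distrib, ← Finset.mul_sum] at hsum
  have h1 : (2 * b)⁻¹ * ∑ i, ∑ j ∈ Finset.univ.erase (σ i), X i j * (ε * (X i j / T i j)) ≤ A := by
    rw [inv_mul_le_iff₀ (by positivity)]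
    exact hle
  have h2 : 2 * b / ε * m ≤ 2 * b / ε * ((K : ℝ) ^ 2 * Real.exp (-δ / ε)) :=
    mul_le_mul_of_nonneg_left hmass (by positivity)
  have h3 : 2 * b / ε * ((K : ℝ) ^ 2 * Real.exp (-δ / ε)) =
      2 * b * ((K : ℝ) ^ 2 * (ε⁻¹ * Real.exp (-δ / ε))) := by
    field_simp
  linarith

/-- The response of the coupling to a perturbation `Y`, paired with a bounded matrix, is
exponentially small. -/
theorem abs_sum_mul_fderiv_sinkhornFun_le {ε δ : ℝ} (hε : 0 < ε) {S : Fin K → Fin K → ℝ}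
    {σ : Fin K → Fin K} (hσ : Function.Bijective σ)
    (hgap : ∀ i j, j ≠ σ i → S i j + δ ≤ S i (σ i)) (hS : ∀ i j, |S i j| ≤ 1)
    {Y : Fin K → Fin K → ℝ} {b : ℝ} (hb : 0 < b) (hY : ∀ i j, |Y i j| ≤ b) :
    |∑ i, ∑ j, fderiv ℝ (sinkhornFun ε) S Y i j * S i j| ≤
      4 * b * ((K : ℝ) ^ 2 * (ε⁻¹ * Real.exp (-δ / ε))) := by
  have h1 := (isBalanced_fderiv_sinkhornFun hε S Y).abs_sum_mul_le hS σ
  have h2 := sum_off_abs_fderiv_le hε hσ hgap hb hY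
  linarith

end SlotMatching
end

/-! ### Gradients with respect to a query slot. -/

noncomputable section
namespace SlotMatching

variable {K D : ℕ}

/-- The similarities as a function of two indices. -/
def simFun (q c : Fin K → EuclideanSpace ℝ (Fin D)) : Fin K → Fin K → ℝ :=
  fun i j => cosSim (q i) (c j)

theorem coupling_eq_sinkhornFun (ε : ℝ) (q c : Fin K → EuclideanSpace ℝ (Fin D)) (i j : Fin K) :
    coupling ε q c i j = sinkhornFun ε (simFun q c) i j := rfl

/-- Whichever entry `a` is deleted from row `i`, either `j` or `σ i` survives, and both carry a
value at least `S i j`. So `S i j` is at most the second maximum. -/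
theorem gap_of_minGap {S : Matrix (Fin K) (Fin K) ℝ} {δ : ℝ} {σ : Fin K → Fin K}
    (hgap : minGap S = δ) (hσ : IsRowArgmax S σ) (i j : Fin K) (hj : j ≠ σ i) :
    S i j + δ ≤ S i (σ i) := by
  have h1 : δ ≤ rowMax S i - rowSecondMax S i := by
    rw [← hgap]
    exact ciInf_le (Set.finite_range _).bddBelow i
  have : Nonempty (Fin K) := ⟨i⟩
  have h2 : rowMax S i ≤ S i (σ i) := ciSup_le fun k' => hσ i k'
  have h3 : S i j ≤ rowSecondMax S i := by
    refine le_ciInf fun a => ?_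
    by_cases ha : j = a
    · have hne : σ i ≠ a := fun h => hj (ha.trans h.symm)
      exact (hσ i j).trans
        (le_ciSup (f := fun k' : {k' : Fin K // k' ≠ a} => S i k')
          (Set.finite_range _).bddAbove ⟨σ i, hne⟩)
    · exact le_ciSup (f := fun k' : {k' : Fin K // k' ≠ a} => S i k')
          (Set.finite_range _).bddAbove ⟨j, ha⟩
  linarith

theorem abs_cosSim_le_one (x y : EuclideanSpace ℝ (Fin D)) : |cosSim x y| ≤ 1 :=
  abs_real_inner_div_norm_mul_norm_le_one x y

theorem inner_perpProj (z v w : EuclideanSpace ℝ (Fin D)) :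
    inner ℝ (perpProj z v) w = inner ℝ v w - inner ℝ z v * inner ℝ z w := by
  simp [perpProj, inner_sub_left, inner_smul_left]

theorem perpProj_sub (z v w : EuclideanSpace ℝ (Fin D)) :
    perpProj z v - perpProj z w = perpProj z (v - w) := by
  simp only [perpProj, inner_sub_right, sub_smul]
  abel

theorem norm_perpProj_le {z : EuclideanSpace ℝ (Fin D)} (hz : ‖z‖ = 1)
    (v : EuclideanSpace ℝ (Fin D)) : ‖perpProj z v‖ ≤ ‖v‖ := by
  have h : ‖perpProj z v‖ ^ 2 = ‖v‖ ^ 2 - inner ℝ z v ^ 2 := by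
    have hzz : inner ℝ z (perpProj z v) = 0 := by
      rw [perpProj, inner_sub_right, inner_smul_right, real_inner_self_eq_norm_sq, hz]
      ring
    rw [← real_inner_self_eq_norm_sq, inner_perpProj, hzz, real_inner_comm, inner_perpProj,
      real_inner_self_eq_norm_sq]
    ring
  refine abs_le_of_sq_le_sq' ?_ (norm_nonneg _) |>.2
  rw [h]
  nlinarith [sq_nonneg (inner ℝ z v)]

/-- At unit vectors, differentiating the factor `1 / ‖w‖` contributes `-⟨x, y⟩ x`, which turns `y`
into its tangential projection. -/
theorem hasFDerivAt_cosSim {x y : EuclideanSpace ℝ (Fin D)} (hx : ‖x‖ = 1) (hy : ‖y‖ = 1) :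
    HasFDerivAt (fun w => cosSim w y) (innerSL ℝ (perpProj x y)) x := by
  have h1 : HasFDerivAt (fun w : EuclideanSpace ℝ (Fin D) => inner ℝ w y) (innerSL ℝ y) x := by
    have := (innerSL ℝ y).hasFDerivAt (x := x)
    refine this.congr_of_eventuallyEq (Eventually.of_forall fun w => ?_)
    simp [real_inner_comm]
  have h2 : HasFDerivAt (fun w : EuclideanSpace ℝ (Fin D) => ‖w‖) (innerSL ℝ x) x := by
    have h3 := (hasStrictFDerivAt_norm_sq x).hasFDerivAt.sqrt (by simp [hx])
    simp only [Real.sqrt_sq (norm_nonneg _), hx] at h3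
    refine h3.congr_fderiv ?_
    ext v
    simp
  have h4 := h1.fun_mul ((hasDerivAt_inv (x := ‖x‖ * ‖y‖) (by simp [hx, hy])).comp_hasFDerivAt x
    (h2.mul_const ‖y‖))
  refine h4.congr_fderiv ?_
  ext v
  simp only [innerSL_apply_apply, inner_perpProj]
  simp [hx, hy]
  ring

/-- The derivative of the similarities with respect to query slot `k`. -/
def simDeriv (q c : Fin K → EuclideanSpace ℝ (Fin D)) (k : Fin K) :
    EuclideanSpace ℝ (Fin D) →L[ℝ] (Fin K → Fin K → ℝ) :=
  ContinuousLinearMap.pi fun i => ContinuousLinearMap.pi fun j =>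
    if i = k then innerSL ℝ (perpProj (q k) (c j)) else 0

theorem simDeriv_apply (q c : Fin K → EuclideanSpace ℝ (Fin D)) (k i j : Fin K)
    (v : EuclideanSpace ℝ (Fin D)) :
    simDeriv q c k v i j = if i = k then inner ℝ (perpProj (q k) (c j)) v else 0 := by
  by_cases h : i = k <;> simp [simDeriv, h]

theorem hasFDerivAt_simFun {q c : Fin K → EuclideanSpace ℝ (Fin D)} (hq : ∀ k, ‖q k‖ = 1)
    (hc : ∀ k, ‖c k‖ = 1) (k : Fin K) :
    HasFDerivAt (fun w => simFun (Function.update q k w) c) (simDeriv q c k) (q k) := by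
  refine hasFDerivAt_pi.2 fun i => hasFDerivAt_pi.2 fun j => ?_
  by_cases h : i = k
  · subst h
    simpa [simFun] using hasFDerivAt_cosSim (hq i) (hc j)
  · simpa [simFun, h] using hasFDerivAt_const _ _

theorem hasFDerivAt_couplingEntry {ε : ℝ} (hε : 0 < ε) {q c : Fin K → EuclideanSpace ℝ (Fin D)}
    (hq : ∀ k, ‖q k‖ = 1) (hc : ∀ k, ‖c k‖ = 1) (k i j : Fin K) :
    HasFDerivAt (couplingEntry ε q c k i j)
      ((ContinuousLinearMap.proj (R := ℝ) (φ := fun _ : Fin K => ℝ) j).comp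
        ((ContinuousLinearMap.proj (R := ℝ) (φ := fun _ : Fin K => Fin K → ℝ) i).comp
        ((fderiv ℝ (sinkhornFun ε) (simFun q c)).comp (simDeriv q c k)))) (q k) := by
  have h1 : HasFDerivAt (sinkhornFun ε) (fderiv ℝ (sinkhornFun ε) (simFun q c))
      (simFun (Function.update q k (q k)) c) := by
    rw [Function.update_eq_self]
    exact (analyticAt_sinkhornFun hε (simFun q c)).differentiableAt.hasFDerivAt
  have h2 := HasFDerivAt.comp (q k) h1 (hasFDerivAt_simFun hq hc k)
  exact hasFDerivAt_pi'.1 (hasFDerivAt_pi'.1 h2 i) j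

theorem inner_gradient_eq {f : EuclideanSpace ℝ (Fin D) → ℝ}
    {f' : EuclideanSpace ℝ (Fin D) →L[ℝ] ℝ} {x : EuclideanSpace ℝ (Fin D)}
    (h : HasFDerivAt f f' x) (v : EuclideanSpace ℝ (Fin D)) :
    inner ℝ (gradient f x) v = f' v := by
  rw [gradient, h.fderiv, InnerProductSpace.toDual_symm_apply]

theorem inner_indirectGrad {ε : ℝ} (hε : 0 < ε) {q c : Fin K → EuclideanSpace ℝ (Fin D)}
    (hq : ∀ k, ‖q k‖ = 1) (hc : ∀ k, ‖c k‖ = 1) (k : Fin K) (v : EuclideanSpace ℝ (Fin D)) :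
    inner ℝ (indirectGrad ε q c k) v = 1 / (K : ℝ) * ∑ i, ∑ j,
      fderiv ℝ (sinkhornFun ε) (simFun q c) (simDeriv q c k v) i j * simFun q c i j := by
  rw [indirectGrad, real_inner_smul_left, sum_inner]
  congr 1
  refine Finset.sum_congr rfl fun i _ => ?_
  rw [sum_inner]
  refine Finset.sum_congr rfl fun j _ => ?_
  rw [real_inner_smul_left, inner_gradient_eq (hasFDerivAt_couplingEntry hε hq hc k i j), mul_comm]
  rfl

theorem inner_directGrad (ε : ℝ) (q c : Fin K → EuclideanSpace ℝ (Fin D)) (k : Fin K)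
    (v : EuclideanSpace ℝ (Fin D)) :
    inner ℝ (directGrad ε q c k) v = 1 / (K : ℝ) * ∑ i, ∑ j,
      sinkhornFun ε (simFun q c) i j * simDeriv q c k v i j := by
  rw [directGrad, real_inner_smul_left]
  congr 1
  rw [Finset.sum_eq_single (a := k) (s := Finset.univ)
    (f := fun i => ∑ j, sinkhornFun ε (simFun q c) i j * simDeriv q c k v i j)]
  · simp only [simDeriv_apply, if_true, inner_perpProj, sum_inner, inner_sum, inner_smul_left,
      inner_smul_right, mul_sub, Finset.sum_sub_distrib, Finset.sum_mul, coupling_eq_sinkhornFun]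
    simp [mul_assoc]
  · intro i _ hi
    simp [simDeriv_apply, hi]
  · simp

/-- This is the product rule for `∑ T S`, checked by pairing both sides with an arbitrary vector. -/
theorem fullGrad_eq {ε : ℝ} (hε : 0 < ε) {q c : Fin K → EuclideanSpace ℝ (Fin D)}
    (hq : ∀ k, ‖q k‖ = 1) (hc : ∀ k, ‖c k‖ = 1) (k : Fin K) :
    fullGrad ε q c k = directGrad ε q c k + indirectGrad ε q c k := by
  have hS : ∀ i j, HasFDerivAt (fun w => cosSim (Function.update q k w i) (c j))
      ((ContinuousLinearMap.proj (R := ℝ) (φ := fun _ : Fin K => ℝ) j).comp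
        ((ContinuousLinearMap.proj (R := ℝ) (φ := fun _ : Fin K => Fin K → ℝ) i).comp
          (simDeriv q c k))) (q k) := fun i j =>
    hasFDerivAt_pi'.1 (hasFDerivAt_pi'.1 (hasFDerivAt_simFun hq hc k) i) j
  have h := HasFDerivAt.const_mul (HasFDerivAt.fun_sum fun i (_ : i ∈ Finset.univ) =>
    HasFDerivAt.fun_sum fun j (_ : j ∈ Finset.univ) =>
      (hasFDerivAt_couplingEntry hε hq hc k i j).mul (hS i j)) (1 / (K : ℝ))
  refine ext_inner_right ℝ fun v => ?_
  rw [inner_add_left, inner_directGrad, inner_indirectGrad hε hq hc]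
  refine (inner_gradient_eq h v).trans ?_
  rw [← mul_add, ← Finset.sum_add_distrib]
  simp only [smul_apply, sum_apply, smul_eq_mul]
  congr 1
  refine Finset.sum_congr rfl fun i _ => ?_
  rw [← Finset.sum_add_distrib]
  refine Finset.sum_congr rfl fun j _ => ?_
  simp [couplingEntry, coupling_eq_sinkhornFun, simFun, mul_comm]

theorem norm_indirectGrad_le {ε δ : ℝ} (hε : 0 < ε) {q c : Fin K → EuclideanSpace ℝ (Fin D)}
    (hq : ∀ k, ‖q k‖ = 1) (hc : ∀ k, ‖c k‖ = 1) {σ : Fin K → Fin K} (hσ : Function.Bijective σ)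
    (hgap : ∀ i j, j ≠ σ i → simFun q c i j + δ ≤ simFun q c i (σ i)) (k : Fin K) :
    ‖indirectGrad ε q c k‖ ≤ 4 * (K : ℝ) ^ 2 * (ε⁻¹ * Real.exp (-δ / ε)) := by
  set G := indirectGrad ε q c k with hG
  have hK : (1 : ℝ) ≤ K := by exact_mod_cast k.pos
  by_cases h0 : G = 0
  · rw [h0, norm_zero]
    positivity
  have hGpos : 0 < ‖G‖ := norm_pos_iff.2 h0
  -- The gradient `G` is itself the direction of differentiation: the similarities then vary at rate
  -- at most `‖G‖`, while the pairing is `‖G‖²`, so one factor `‖G‖` cancels.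
  have h1 := abs_sum_mul_fderiv_sinkhornFun_le hε hσ hgap
    (fun i j => abs_cosSim_le_one _ _) hGpos (Y := simDeriv q c k G) fun i j => by
      rw [simDeriv_apply]
      split_ifs
      · refine (abs_real_inner_le_norm _ _).trans ?_
        have := norm_perpProj_le (hq k) (c j)
        rw [hc j] at this
        exact mul_le_of_le_one_left (norm_nonneg _) this
      · simp
  have h2 := inner_indirectGrad hε hq hc k G
  rw [← hG, real_inner_self_eq_norm_sq] at h2
  have h3 : ‖G‖ ^ 2 ≤ 4 * ‖G‖ * ((K : ℝ) ^ 2 * (ε⁻¹ * Real.exp (-δ / ε))) := by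
    rw [h2]
    refine (le_abs_self _).trans ?_
    rw [abs_mul]
    refine le_trans (mul_le_of_le_one_left (abs_nonneg _) ?_) h1
    rw [abs_of_nonneg (by positivity), div_le_one (by positivity)]
    exact hK
  have h4 : ‖G‖ * ‖G‖ ≤ ‖G‖ * (4 * (K : ℝ) ^ 2 * (ε⁻¹ * Real.exp (-δ / ε))) := by
    calc ‖G‖ * ‖G‖ = ‖G‖ ^ 2 := by ring
      _ ≤ _ := h3
      _ = _ := by ring
  exact le_of_mul_le_mul_left h4 hGpos

theorem norm_directGrad_sub_hardGrad_le {ε δ : ℝ} (hε : 0 < ε)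
    {q c : Fin K → EuclideanSpace ℝ (Fin D)}
    (hq : ∀ k, ‖q k‖ = 1) (hc : ∀ k, ‖c k‖ = 1) {σ : Fin K → Fin K} (hσ : Function.Bijective σ)
    (hgap : ∀ i j, j ≠ σ i → simFun q c i j + δ ≤ simFun q c i (σ i)) (k : Fin K) :
    ‖directGrad ε q c k - hardGrad q c σ k‖ ≤ 4 * (K : ℝ) ^ 2 * Real.exp (-δ / ε) := by
  have hK : (1 : ℝ) ≤ K := by exact_mod_cast k.pos
  set T := sinkhornFun ε (simFun q c) with hT
  rw [directGrad, hardGrad, ← smul_sub, perpProj_sub, norm_smul]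
  -- The off-graph mass of row `k` counts twice: as the total weight of the wrong supports, and as
  -- the weight missing from `c (σ k)`.
  have h1 : ‖∑ j, coupling ε q c k j • c j - c (σ k)‖ ≤ 2 * (1 - T k (σ k)) := by
    have e : ∑ j, coupling ε q c k j • c j - c (σ k) =
        ∑ j ∈ Finset.univ.erase (σ k), T k j • c j - (1 - T k (σ k)) • c (σ k) := by
      simp only [coupling_eq_sinkhornFun, ← hT]
      rw [← Finset.add_sum_erase _ _ (Finset.mem_univ (σ k)), sub_smul, one_smul]
      abel
    rw [e]
    refine (norm_sub_le _ _).trans ?_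
    have h2 : ‖∑ j ∈ Finset.univ.erase (σ k), T k j • c j‖ ≤ 1 - T k (σ k) := by
      refine (norm_sum_le _ _).trans ?_
      rw [hT, ← sum_erase_sinkhornFun]
      refine le_of_eq (Finset.sum_congr rfl fun j _ => ?_)
      rw [norm_smul, hc, mul_one, Real.norm_of_nonneg (sinkhornFun_pos hε _ _ _).le]
    have h3 : ‖(1 - T k (σ k)) • c (σ k)‖ = 1 - T k (σ k) := by
      rw [norm_smul, hc, mul_one, Real.norm_of_nonneg]
      exact sub_nonneg.2 (sinkhornFun_le_one hε _ _ _)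
    linarith
  have h2 := one_sub_sinkhornFun_le hε hσ hgap k
  rw [← hT] at h2
  have h3 : ‖(1 : ℝ) / K‖ ≤ 1 := by
    rw [Real.norm_of_nonneg (by positivity), div_le_one (by positivity)]
    exact hK
  refine (mul_le_of_le_one_left (norm_nonneg _) h3).trans ?_
  refine (norm_perpProj_le (hq k) _).trans (h1.trans ?_)
  have : 0 < (K : ℝ) ^ 2 * Real.exp (-δ / ε) := by positivity
  linarith

theorem tendsto_inv_mul_exp_neg_div {c : ℝ} (hc : 0 < c) :
    Tendsto (fun ε : ℝ => ε⁻¹ * Real.exp (-c / ε)) (𝓝[>] 0) (𝓝 0) := by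
  have h := (tendsto_rpow_mul_exp_neg_mul_atTop_nhds_zero 1 c hc).comp
    (tendsto_inv_nhdsGT_zero (𝕜 := ℝ))
  refine h.congr fun ε => ?_
  simp [div_eq_mul_inv]

end SlotMatching
end

/-! ### Analyticity of the Jacobian and its Gram determinant. -/

open scoped ContDiff
noncomputable section
namespace SlotMatching

variable {K D : ℕ}

/-- Configurations all of whose slots are nonzero. -/
def nonzeroSlots (K D : ℕ) :
    Set ((Fin K → EuclideanSpace ℝ (Fin D)) × (Fin K → EuclideanSpace ℝ (Fin D))) :=
  {x | (∀ k, x.1 k ≠ 0) ∧ ∀ k, x.2 k ≠ 0}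

theorem isOpen_nonzeroSlots : IsOpen (nonzeroSlots K D) := by
  have h : nonzeroSlots K D = (⋂ k, {x | x.1 k ≠ 0}) ∩ ⋂ k, {x | x.2 k ≠ 0} := by
    ext x
    simp [nonzeroSlots]
  rw [h]
  exact (isOpen_iInter_of_finite fun k => isOpen_ne_fun (by fun_prop) continuous_const).inter
    (isOpen_iInter_of_finite fun k => isOpen_ne_fun (by fun_prop) continuous_const)

theorem contDiffAt_score {ε : ℝ} (hε : 0 < ε)
    {x : (Fin K → EuclideanSpace ℝ (Fin D)) × (Fin K → EuclideanSpace ℝ (Fin D))}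
    (hx : x ∈ nonzeroSlots K D) :
    ContDiffAt ℝ ω (fun y : (Fin K → EuclideanSpace ℝ (Fin D)) ×
      (Fin K → EuclideanSpace ℝ (Fin D)) => score ε y.1 y.2) x := by
  have h1 : ∀ k, ContDiffAt ℝ ω (fun y : (Fin K → EuclideanSpace ℝ (Fin D)) ×
      (Fin K → EuclideanSpace ℝ (Fin D)) => y.1 k) x := fun k => by fun_prop
  have h2 : ∀ k, ContDiffAt ℝ ω (fun y : (Fin K → EuclideanSpace ℝ (Fin D)) ×
      (Fin K → EuclideanSpace ℝ (Fin D)) => y.2 k) x := fun k => by fun_prop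
  have hS : ∀ i j, ContDiffAt ℝ ω (fun y : (Fin K → EuclideanSpace ℝ (Fin D)) ×
      (Fin K → EuclideanSpace ℝ (Fin D)) => cosSim (y.1 i) (y.2 j)) x := fun i j =>
    ((h1 i).inner ℝ (h2 j)).div (((h1 i).norm ℝ (hx.1 i)).mul ((h2 j).norm ℝ (hx.2 j)))
      (mul_ne_zero (norm_ne_zero_iff.2 (hx.1 i)) (norm_ne_zero_iff.2 (hx.2 j)))
  have hsim : ContDiffAt ℝ ω (fun y : (Fin K → EuclideanSpace ℝ (Fin D)) ×
      (Fin K → EuclideanSpace ℝ (Fin D)) => simFun y.1 y.2) x :=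
    contDiffAt_pi.2 fun i => contDiffAt_pi.2 fun j => hS i j
  have hT := ContDiffAt.comp x (analyticAt_sinkhornFun hε (simFun x.1 x.2)).contDiffAt hsim
  have hT' : ∀ i j, ContDiffAt ℝ ω (fun y : (Fin K → EuclideanSpace ℝ (Fin D)) ×
      (Fin K → EuclideanSpace ℝ (Fin D)) => coupling ε y.1 y.2 i j) x := fun i j =>
    contDiffAt_pi.1 (contDiffAt_pi.1 hT i) j
  exact contDiffAt_const.mul (ContDiffAt.sum fun i _ => ContDiffAt.sum fun j _ =>
    (hT' i j).mul (hS i j))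

/-- Expressing the partial gradient through the derivative of the score in all slots jointly makes
its analyticity in the whole configuration immediate. -/
theorem fullGrad_apply_eq_fderiv {ε : ℝ} (hε : 0 < ε)
    {x : (Fin K → EuclideanSpace ℝ (Fin D)) × (Fin K → EuclideanSpace ℝ (Fin D))}
    (hx : x ∈ nonzeroSlots K D) (k : Fin K) (i : Fin D) :
    fullGrad ε x.1 x.2 k i =
      fderiv ℝ (fun y : (Fin K → EuclideanSpace ℝ (Fin D)) ×
        (Fin K → EuclideanSpace ℝ (Fin D)) => score ε y.1 y.2) x
        (Pi.single k (EuclideanSpace.single i 1), 0) := by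
  have hd := ((contDiffAt_score hε hx).differentiableAt (by simp)).hasFDerivAt
  have hu : HasFDerivAt (fun w => (Function.update x.1 k w, x.2)) _ (x.1 k) :=
    (hasFDerivAt_update (𝕜 := ℝ) (E := fun _ : Fin K => EuclideanSpace ℝ (Fin D)) (i := k)
      x.1 (x.1 k)).prodMk (hasFDerivAt_const x.2 (x.1 k))
  have hd' : HasFDerivAt (fun y : (Fin K → EuclideanSpace ℝ (Fin D)) ×
        (Fin K → EuclideanSpace ℝ (Fin D)) => score ε y.1 y.2)
      (fderiv ℝ (fun y : (Fin K → EuclideanSpace ℝ (Fin D)) ×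
        (Fin K → EuclideanSpace ℝ (Fin D)) => score ε y.1 y.2) x)
      ((fun w => (Function.update x.1 k w, x.2)) (x.1 k)) := by
    simpa using hd
  have h := inner_gradient_eq (hd'.comp (x.1 k) hu) (EuclideanSpace.single i (1 : ℝ))
  have h2 : fullGrad ε x.1 x.2 k i =
      inner ℝ (fullGrad ε x.1 x.2 k) (EuclideanSpace.single i (1 : ℝ)) := by
    simp [EuclideanSpace.inner_single_right]
  rw [h2]
  refine h.trans ?_
  rw [ContinuousLinearMap.comp_apply]
  congr 1
  refine Prod.ext ?_ rfl
  funext j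
  by_cases hj : j = k
  · subst hj
    simp
  · simp [hj]

theorem analyticAt_jacobian {ε : ℝ} (hε : 0 < ε)
    {x : (Fin K → EuclideanSpace ℝ (Fin D)) × (Fin K → EuclideanSpace ℝ (Fin D))}
    (hx : x ∈ nonzeroSlots K D) (k : Fin K) (i : Fin D) :
    AnalyticAt ℝ (fun y : (Fin K → EuclideanSpace ℝ (Fin D)) ×
      (Fin K → EuclideanSpace ℝ (Fin D)) => jacobian ε y.1 y.2 k i) x := by
  have h1 := (contDiffAt_score hε hx).analyticAt.fderiv
  have h2 := ((ContinuousLinearMap.apply ℝ ℝ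
    ((Pi.single k (EuclideanSpace.single i 1), 0) : (Fin K → EuclideanSpace ℝ (Fin D)) ×
      (Fin K → EuclideanSpace ℝ (Fin D)))).analyticAt _).comp h1
  refine h2.congr ?_
  filter_upwards [isOpen_nonzeroSlots.mem_nhds hx] with y hy
  exact (fullGrad_apply_eq_fderiv hε hy k i).symm

/-- The Gram determinant of the rows of the Jacobian. -/
def gramDet (ε : ℝ)
    (x : (Fin K → EuclideanSpace ℝ (Fin D)) × (Fin K → EuclideanSpace ℝ (Fin D))) : ℝ :=
  (jacobian ε x.1 x.2 * (jacobian ε x.1 x.2).transpose).det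

theorem analyticAt_gramDet {ε : ℝ} (hε : 0 < ε)
    {x : (Fin K → EuclideanSpace ℝ (Fin D)) × (Fin K → EuclideanSpace ℝ (Fin D))}
    (hx : x ∈ nonzeroSlots K D) : AnalyticAt ℝ (gramDet ε) x := by
  have h : (gramDet ε : (Fin K → EuclideanSpace ℝ (Fin D)) ×
      (Fin K → EuclideanSpace ℝ (Fin D)) → ℝ) = fun y => ∑ τ : Equiv.Perm (Fin K),
        ((Equiv.Perm.sign τ : ℤ) : ℝ) * ∏ k, ∑ i, jacobian ε y.1 y.2 (τ k) i *
          jacobian ε y.1 y.2 k i := by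
    funext y
    simp [gramDet, Matrix.det_apply', Matrix.mul_apply]
  rw [h]
  refine Finset.analyticAt_fun_sum _ fun τ _ => analyticAt_const.mul ?_
  refine Finset.analyticAt_fun_prod _ fun k _ => Finset.analyticAt_fun_sum _ fun i _ => ?_
  exact (analyticAt_jacobian hε hx _ _).mul (analyticAt_jacobian hε hx _ _)

theorem gramDet_eq_zero_of_rank_lt {ε : ℝ}
    {x : (Fin K → EuclideanSpace ℝ (Fin D)) × (Fin K → EuclideanSpace ℝ (Fin D))}
    (h : (jacobian ε x.1 x.2).rank < K) : gramDet ε x = 0 := by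
  by_contra hne
  rw [← Matrix.rank_self_mul_transpose, Matrix.rank_of_isUnit] at h
  · simp at h
  · rw [Matrix.isUnit_iff_isUnit_det]
    exact isUnit_iff_ne_zero.2 hne

/-- If `J Jᵀ` is singular, some nonzero `v` satisfies `v J Jᵀ = 0`, hence `v J = 0` over the reals,
and then `v` annihilates `J B` too. Thus one nonsingular `K × K` compression suffices. -/
theorem gramDet_ne_zero_of_det_mul_ne_zero {ε : ℝ}
    {x : (Fin K → EuclideanSpace ℝ (Fin D)) × (Fin K → EuclideanSpace ℝ (Fin D))}
    (B : Matrix (Fin D) (Fin K) ℝ) (h : (jacobian ε x.1 x.2 * B).det ≠ 0) :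
    gramDet ε x ≠ 0 := by
  contrapose! h
  obtain ⟨v, hv, hv0⟩ := Matrix.exists_vecMul_eq_zero_iff.2 h
  refine Matrix.exists_vecMul_eq_zero_iff.1 ⟨v, hv, ?_⟩
  have h1 : Matrix.vecMul v (jacobian ε x.1 x.2) = 0 := by
    rw [← Matrix.conjTranspose_eq_transpose_of_trivial] at hv0
    exact (Matrix.vecMul_self_mul_conjTranspose_eq_zero _ _).1 hv0
  rw [← Matrix.vecMul_vecMul, h1, Matrix.zero_vecMul]

/-- Scale every slot to unit length. -/
def normalizeSlots
    (x : (Fin K → EuclideanSpace ℝ (Fin D)) × (Fin K → EuclideanSpace ℝ (Fin D))) :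
    (Fin K → EuclideanSpace ℝ (Fin D)) × (Fin K → EuclideanSpace ℝ (Fin D)) :=
  (fun k => ‖x.1 k‖⁻¹ • x.1 k, fun k => ‖x.2 k‖⁻¹ • x.2 k)

theorem normalizeSlots_mem
    {x : (Fin K → EuclideanSpace ℝ (Fin D)) × (Fin K → EuclideanSpace ℝ (Fin D))}
    (hx : x ∈ nonzeroSlots K D) : normalizeSlots x ∈ nonzeroSlots K D :=
  ⟨fun k => smul_ne_zero (inv_ne_zero (norm_ne_zero_iff.2 (hx.1 k))) (hx.1 k),
    fun k => smul_ne_zero (inv_ne_zero (norm_ne_zero_iff.2 (hx.2 k))) (hx.2 k)⟩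

theorem analyticAt_normalizeSlots
    {x : (Fin K → EuclideanSpace ℝ (Fin D)) × (Fin K → EuclideanSpace ℝ (Fin D))}
    (hx : x ∈ nonzeroSlots K D) : AnalyticAt ℝ normalizeSlots x := by
  refine ContDiffAt.analyticAt ?_
  have h1 : ∀ k, ContDiffAt ℝ ω (fun y : (Fin K → EuclideanSpace ℝ (Fin D)) ×
      (Fin K → EuclideanSpace ℝ (Fin D)) => y.1 k) x := fun k => by fun_prop
  have h2 : ∀ k, ContDiffAt ℝ ω (fun y : (Fin K → EuclideanSpace ℝ (Fin D)) ×
      (Fin K → EuclideanSpace ℝ (Fin D)) => y.2 k) x := fun k => by fun_prop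
  exact ContDiffAt.prodMk
    (contDiffAt_pi.2 fun k => (((h1 k).norm ℝ (hx.1 k)).inv
      (norm_ne_zero_iff.2 (hx.1 k))).smul (h1 k))
    (contDiffAt_pi.2 fun k => (((h2 k).norm ℝ (hx.2 k)).inv
      (norm_ne_zero_iff.2 (hx.2 k))).smul (h2 k))

theorem analyticAt_gramDet_normalizeSlots {ε : ℝ} (hε : 0 < ε)
    {x : (Fin K → EuclideanSpace ℝ (Fin D)) × (Fin K → EuclideanSpace ℝ (Fin D))}
    (hx : x ∈ nonzeroSlots K D) : AnalyticAt ℝ (fun y => gramDet ε (normalizeSlots y)) x :=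
  (analyticAt_gramDet hε (normalizeSlots_mem hx)).comp (analyticAt_normalizeSlots hx)

end SlotMatching
end

/-! ### Null zero sets of analytic functions, and passage to the sphere. -/

noncomputable section
namespace SlotMatching

section General

variable {E : Type*} [NormedAddCommGroup E] [NormedSpace ℝ E]

open scoped Classical in
/-- The direction of a vector, as a point of the unit sphere; `e` is the value at zero. -/
def direction (e : Metric.sphere (0 : E) 1) (x : E) : Metric.sphere (0 : E) 1 :=
  if h : x = 0 then e else ⟨‖x‖⁻¹ • x, by simp [norm_smul, h]⟩

theorem coe_direction (e : Metric.sphere (0 : E) 1) {x : E} (hx : x ≠ 0) :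
    (direction e x : E) = ‖x‖⁻¹ • x := by
  simp [direction, hx]

variable [FiniteDimensional ℝ E] [MeasurableSpace E] [BorelSpace E]

/-- The zeros of an analytic function form a null set, if almost every line through some point
where it does not vanish stays in its domain. -/
theorem addHaar_inter_zeros_eq_zero (μ : Measure E) [μ.IsAddHaarMeasure] {W : Set E}
    (hW : IsOpen W) {f : E → ℝ} (hf : ∀ x ∈ W, AnalyticAt ℝ f x) {p : E} (hp : f p ≠ 0)
    (hline : ∀ᵐ x ∂μ, ∀ t : ℝ, p + t • x ∈ W) : μ (W ∩ {x | f x = 0}) = 0 := by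
  have hcont : ContinuousOn f W := fun x hx => (hf x hx).continuousAt.continuousWithinAt
  have hZ : MeasurableSet (W ∩ {x | f x = 0}) := by
    obtain ⟨u, hu, hu'⟩ := continuousOn_iff_isClosed.1 hcont {0} isClosed_singleton
    have : W ∩ {x | f x = 0} = u ∩ W := by
      rw [← hu', Set.inter_comm]
      rfl
    rw [this]
    exact hu.measurableSet.inter hW.measurableSet
  set Z := W ∩ {x | f x = 0} with hZdef
  have hmeas : Measurable fun y : E × ℝ => p + y.2 • y.1 := by fun_prop
  -- On such a line `f` is analytic in one variable and nonzero at `t = 0`, so its zeros are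
  -- discrete and therefore null.
  have hray : ∀ᵐ x ∂μ, volume {t : ℝ | p + t • x ∈ Z} = 0 := by
    filter_upwards [hline] with x hx
    have han : AnalyticOnNhd ℝ (fun t : ℝ => f (p + t • x)) Set.univ := fun t _ =>
      AnalyticAt.fun_comp (hf _ (hx t)) (by fun_prop)
    have hco := han.preimage_zero_mem_codiscreteWithin (x := (0 : ℝ)) (by simpa using hp)
      (Set.mem_univ _) isConnected_univ
    have hae := ae_restrict_le_codiscreteWithin (μ := (volume : Measure ℝ)) MeasurableSet.univ hco
    rw [Measure.restrict_univ, mem_ae_iff] at hae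
    refine measure_mono_null ?_ hae
    intro t ht
    simpa using ht.2
  have hnull : (μ.prod volume) ((fun y : E × ℝ => p + y.2 • y.1) ⁻¹' Z) = 0 := by
    rw [Measure.measure_prod_null (hmeas hZ)]
    exact hray
  -- Exchanging the variables, almost every `t` has a null slice. Any such `t ≠ 0` is enough, since
  -- that slice is the image of `Z` under a translation and a nonzero scaling.
  have hnull' : ((volume : Measure ℝ).prod μ) ((fun y : ℝ × E => p + y.1 • y.2) ⁻¹' Z) = 0 := by
    rw [← Measure.prod_swap, Measure.map_apply measurable_swap]
    · exact hnull
    · exact (show Measurable fun y : ℝ × E => p + y.1 • y.2 by fun_prop) hZ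
  have hslice := Measure.measure_ae_null_of_prod_null hnull'
  have hne : ∀ᵐ t : ℝ, t ≠ 0 := by
    simp [ae_iff]
  obtain ⟨t, ht, ht0⟩ := (hslice.and hne).exists
  have h1 : μ ((t • ·) ⁻¹' ((p + ·) ⁻¹' Z)) = 0 := ht
  rw [Measure.addHaar_preimage_smul μ ht0, measure_preimage_add] at h1
  rcases mul_eq_zero.1 h1 with h | h
  · rw [ENNReal.ofReal_eq_zero] at h
    have : 0 < |(t ^ Module.finrank ℝ E)⁻¹| := by positivity
    linarith
  · exact h

theorem measurable_direction (e : Metric.sphere (0 : E) 1) : Measurable (direction e) := by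
  classical
  have h : Measurable fun x : E => if x = 0 then (e : E) else ‖x‖⁻¹ • x :=
    Measurable.ite (measurableSet_singleton (0 : E)) measurable_const (by fun_prop)
  have h2 : ∀ x, (if x = 0 then (e : E) else ‖x‖⁻¹ • x) ∈ Metric.sphere (0 : E) 1 := by
    intro x
    split_ifs with hx
    · exact e.2
    · simp [norm_smul, hx]
  have h3 : direction e = fun x => ⟨if x = 0 then (e : E) else ‖x‖⁻¹ • x, h2 x⟩ := by
    funext x
    apply Subtype.ext
    by_cases hx : x = 0 <;> simp [direction, hx]
  rw [h3]
  exact h.subtype_mk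

open scoped Pointwise in
/-- The surface measure is the image of a Haar measure on the unit ball under `direction`. -/
theorem toSphere_eq_map_direction (μ : Measure E) [μ.IsAddHaarMeasure]
    (e : Metric.sphere (0 : E) 1) :
    μ.toSphere = (((Module.finrank ℝ E : ENNReal) • μ).restrict (Metric.ball 0 1)).map
      (direction e) := by
  have : Nontrivial E := ⟨e, 0, fun h => by
    have := e.2
    rw [h] at this
    simp at this⟩
  ext s hs
  rw [Measure.toSphere_apply' _ hs, Measure.map_apply (measurable_direction e) hs,
    Measure.restrict_apply (measurable_direction e hs), Measure.smul_apply, smul_eq_mul]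
  congr 1
  -- `toSphere` measures the open cone over `s` inside the unit ball; this is the preimage of `s` in
  -- the ball up to the origin, a null set.
  have hset : Set.Ioo (0 : ℝ) 1 • ((↑) '' s : Set E) =
      (direction e ⁻¹' s ∩ Metric.ball 0 1) \ {0} := by
    ext x
    constructor
    · rintro ⟨r, hr, -, ⟨y, hy, rfl⟩, rfl⟩
      have hny : ‖(y : E)‖ = 1 := by simp
      have hy0 : (y : E) ≠ 0 := fun h => by simp [h] at hny
      have hx0 : r • (y : E) ≠ 0 := smul_ne_zero hr.1.ne' hy0
      refine ⟨⟨?_, ?_⟩, hx0⟩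
      · have : direction e (r • (y : E)) = y := by
          apply Subtype.ext
          rw [coe_direction e hx0, norm_smul, hny, Real.norm_of_nonneg hr.1.le, mul_one, smul_smul,
            inv_mul_cancel₀ hr.1.ne', one_smul]
        change direction e (r • (y : E)) ∈ s
        rwa [this]
      · simp [norm_smul, hny, abs_of_pos hr.1, hr.2]
    · rintro ⟨⟨hx, hb⟩, h0⟩
      have h0 : x ≠ 0 := h0
      refine ⟨‖x‖, ⟨norm_pos_iff.2 h0, by simpa using hb⟩, _, ⟨_, hx, rfl⟩, ?_⟩
      simp only [coe_direction e h0, smul_smul]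
      rw [mul_inv_cancel₀ (norm_ne_zero_iff.2 h0), one_smul]
  rw [hset, measure_sdiff_null (measure_singleton _)]

end General

variable {K D : ℕ}

/-- The product surface measure is the image, under slotwise normalization, of a Haar measure
restricted to a product of balls. Null sets may therefore be tested in the ambient linear space,
where the argument with lines applies. -/
theorem exists_addHaar_ae_of_surfaceMeasure (K : ℕ) {D : ℕ} (hD : 0 < D)
    (e : Sph D) :
    ∃ μ : Measure ((Fin K → EuclideanSpace ℝ (Fin D)) × (Fin K → EuclideanSpace ℝ (Fin D))),
      μ.IsAddHaarMeasure ∧ ∀ B : Set ((Fin K → Sph D) × (Fin K → Sph D)), MeasurableSet B →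
        μ {x | ((fun k => direction e (x.1 k)), fun k => direction e (x.2 k)) ∈ B} = 0 →
        surfaceMeasure K D B = 0 := by
  set ν : Measure (EuclideanSpace ℝ (Fin D)) :=
    (Module.finrank ℝ (EuclideanSpace ℝ (Fin D)) : ENNReal) • volume with hν
  have : ν.IsAddHaarMeasure := Measure.IsAddHaarMeasure.smul _ (by simpa using hD.ne') (by simp)
  have hsph : (volume : Measure (EuclideanSpace ℝ (Fin D))).toSphere =
      (ν.restrict (Metric.ball 0 1)).map (direction e) := toSphere_eq_map_direction volume e
  set N : (Fin K → EuclideanSpace ℝ (Fin D)) → (Fin K → Sph D) :=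
    fun x k => direction e (x k) with hN
  have hNm : Measurable N := measurable_pi_lambda _ fun k =>
    (measurable_direction e).comp (measurable_pi_apply k)
  set ρ : Measure (Fin K → EuclideanSpace ℝ (Fin D)) := Measure.pi fun _ => ν with hρ
  have hfin : IsFiniteMeasure ((ν.restrict (Metric.ball 0 1)).map (direction e)) := by
    rw [← hsph]
    infer_instance
  have hpi : (Measure.pi fun _ : Fin K =>
      (volume : Measure (EuclideanSpace ℝ (Fin D))).toSphere) =
      (ρ.restrict (Set.univ.pi fun _ => Metric.ball 0 1)).map N := by
    rw [hsph, hρ, Measure.restrict_pi_pi, hN,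
      Measure.pi_map_pi fun _ => (measurable_direction e).aemeasurable]
  have hρH : ρ.IsAddHaarMeasure := by
    rw [hρ]
    infer_instance
  have hρρ : (ρ.prod ρ).IsAddHaarMeasure := Measure.prod.instIsAddHaarMeasure ρ ρ
  refine ⟨ρ.prod ρ, hρρ, fun B hB h => ?_⟩
  rw [surfaceMeasure, hpi, Measure.map_prod_map _ _ hNm hNm, Measure.map_apply (hNm.prodMap hNm) hB]
  have hac : (ρ.restrict (Set.univ.pi fun _ => Metric.ball 0 1)).prod
      (ρ.restrict (Set.univ.pi fun _ => Metric.ball 0 1)) ≪ ρ.prod ρ :=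
    Measure.AbsolutelyContinuous.prod Measure.restrict_le_self.absolutelyContinuous
      Measure.restrict_le_self.absolutelyContinuous
  exact hac h

/-- A line in dimension `D ≥ 2` is a proper subspace, so its preimage under a surjection is proper
too, hence Haar-null. -/
theorem ae_notMem_span
    (μ : Measure ((Fin K → EuclideanSpace ℝ (Fin D)) × (Fin K → EuclideanSpace ℝ (Fin D))))
    [μ.IsAddHaarMeasure] (hD : 2 ≤ D)
    (L : (Fin K → EuclideanSpace ℝ (Fin D)) × (Fin K → EuclideanSpace ℝ (Fin D)) →ₗ[ℝ]
      EuclideanSpace ℝ (Fin D)) (hL : Function.Surjective L) (v : EuclideanSpace ℝ (Fin D)) :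
    ∀ᵐ x ∂μ, L x ∉ Submodule.span ℝ {v} := by
  have hne : (Submodule.span ℝ {v}).comap L ≠ ⊤ := by
    intro h
    have h1 : Submodule.span ℝ {v} = ⊤ := by
      rw [← Submodule.map_comap_eq_of_surjective hL (Submodule.span ℝ {v}), h, Submodule.map_top,
        LinearMap.range_eq_top.2 hL]
    have h2 := finrank_span_le_card (R := ℝ) ({v} : Set (EuclideanSpace ℝ (Fin D)))
    rw [h1, finrank_top] at h2
    simp at h2
    omega
  have := Measure.addHaar_submodule μ _ hne
  rw [ae_iff]
  simp only [not_not]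
  exact this

/-- Almost every line through a configuration of nonzero slots meets only such configurations. -/
theorem ae_line_mem_nonzeroSlots
    (μ : Measure ((Fin K → EuclideanSpace ℝ (Fin D)) × (Fin K → EuclideanSpace ℝ (Fin D))))
    [μ.IsAddHaarMeasure] (hD : 2 ≤ D)
    {p : (Fin K → EuclideanSpace ℝ (Fin D)) × (Fin K → EuclideanSpace ℝ (Fin D))}
    (hp : p ∈ nonzeroSlots K D) :
    ∀ᵐ x ∂μ, x ∈ nonzeroSlots K D ∧ ∀ t : ℝ, p + t • x ∈ nonzeroSlots K D := by
  have h1 : ∀ k, ∀ᵐ x ∂μ, x.1 k ∉ Submodule.span ℝ {p.1 k} := fun k =>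
    ae_notMem_span μ hD ((LinearMap.proj k).comp (LinearMap.fst ℝ _ _))
      (fun w => ⟨(fun _ => w, 0), rfl⟩) _
  have h2 : ∀ k, ∀ᵐ x ∂μ, x.2 k ∉ Submodule.span ℝ {p.2 k} := fun k =>
    ae_notMem_span μ hD ((LinearMap.proj k).comp (LinearMap.snd ℝ _ _))
      (fun w => ⟨(0, fun _ => w), rfl⟩) _
  have key : ∀ a b : EuclideanSpace ℝ (Fin D), a ≠ 0 → b ∉ Submodule.span ℝ {a} →
      b ≠ 0 ∧ ∀ t : ℝ, a + t • b ≠ 0 := by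
    intro a b ha hb
    refine ⟨fun h => hb (h ▸ Submodule.zero_mem _), fun t ht => ?_⟩
    have ht0 : t ≠ 0 := by
      rintro rfl
      exact ha (by simpa using ht)
    refine hb (Submodule.mem_span_singleton.2 ⟨-t⁻¹, ?_⟩)
    rw [eq_neg_of_add_eq_zero_left ht, smul_neg, neg_smul, neg_neg, smul_smul,
      inv_mul_cancel₀ ht0, one_smul]
  filter_upwards [ae_all_iff.2 h1, ae_all_iff.2 h2] with x hx1 hx2
  exact ⟨⟨fun k => (key _ _ (hp.1 k) (hx1 k)).1, fun k => (key _ _ (hp.2 k) (hx2 k)).1⟩,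
    fun t => ⟨fun k => (key _ _ (hp.1 k) (hx1 k)).2 t, fun k => (key _ _ (hp.2 k) (hx2 k)).2 t⟩⟩

/-- One configuration of unit slots with a nonsingular Jacobian makes the rank generic. -/
theorem surfaceMeasure_rank_lt_eq_zero {ε : ℝ} (hε : 0 < ε) (hK : 0 < K) (hD : 2 ≤ D)
    {p : (Fin K → EuclideanSpace ℝ (Fin D)) × (Fin K → EuclideanSpace ℝ (Fin D))}
    (h1 : ∀ k, ‖p.1 k‖ = 1) (h2 : ∀ k, ‖p.2 k‖ = 1) (hp : gramDet ε p ≠ 0) :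
    surfaceMeasure K D {z | (jacobian ε (vecs z.1) (vecs z.2)).rank < K} = 0 := by
  have hpW : p ∈ nonzeroSlots K D :=
    ⟨fun k h => by simpa [h] using h1 k, fun k h => by simpa [h] using h2 k⟩
  -- Normalization fixes `p`, so the nonvanishing at `p` carries over to the Gram determinant
  -- composed with normalization.
  have hpn : normalizeSlots p = p := by
    simp [normalizeSlots, h1, h2]
  let e : Sph D := ⟨p.1 ⟨0, hK⟩, by simp [h1]⟩
  obtain ⟨μ, hμ, hsurf⟩ := exists_addHaar_ae_of_surfaceMeasure K (by omega : 0 < D) e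
  have hcont : Continuous fun z : (Fin K → Sph D) × (Fin K → Sph D) =>
      gramDet ε (vecs z.1, vecs z.2) := by
    rw [continuous_iff_continuousAt]
    intro z
    have hz : (vecs z.1, vecs z.2) ∈ nonzeroSlots K D :=
      ⟨fun k => ne_zero_of_mem_unit_sphere (z.1 k), fun k => ne_zero_of_mem_unit_sphere (z.2 k)⟩
    refine ContinuousAt.comp (f := fun z : (Fin K → Sph D) × (Fin K → Sph D) =>
      (vecs z.1, vecs z.2)) (analyticAt_gramDet hε hz).continuousAt ?_
    have : Continuous fun z : (Fin K → Sph D) × (Fin K → Sph D) => (vecs z.1, vecs z.2) := by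
      unfold vecs
      fun_prop
    exact this.continuousAt
  have hB : MeasurableSet {z : (Fin K → Sph D) × (Fin K → Sph D) |
      gramDet ε (vecs z.1, vecs z.2) = 0} :=
    (isClosed_eq hcont continuous_const).measurableSet
  refine measure_mono_null (fun z hz => gramDet_eq_zero_of_rank_lt (x := (vecs z.1, vecs z.2)) hz)
    (hsurf _ hB ?_)
  have hline := ae_line_mem_nonzeroSlots μ hD hpW
  have hzero := addHaar_inter_zeros_eq_zero μ isOpen_nonzeroSlots
    (fun x hx => analyticAt_gramDet_normalizeSlots hε hx) (p := p) (by rwa [hpn])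
    (hline.mono fun x hx => hx.2)
  have hW0 : μ (nonzeroSlots K D)ᶜ = 0 := by
    rw [← mem_ae_iff]
    exact hline.mono fun x hx => hx.1
  refine measure_mono_null ?_ (measure_union_null hzero hW0)
  intro x hx
  by_cases hxW : x ∈ nonzeroSlots K D
  · refine Or.inl ⟨hxW, ?_⟩
    have hN : (vecs (fun k => direction e (x.1 k)), vecs (fun k => direction e (x.2 k))) =
        normalizeSlots x := by
      refine Prod.ext ?_ ?_
      · funext k
        exact coe_direction e (hxW.1 k)
      · funext k
        exact coe_direction e (hxW.2 k)
    rw [Set.mem_ofPred_eq, ← hN]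
    exact hx
  · exact Or.inr hxW

end SlotMatching
end

/-! ### A configuration with independent gradients. -/

noncomputable section
namespace SlotMatching

variable {K D : ℕ}

/-- The query slots `e_k` of a configuration with orthogonal matched pairs. -/
def modelQuery (hD : 2 * K ≤ D) (k : Fin K) : EuclideanSpace ℝ (Fin D) :=
  EuclideanSpace.single ⟨k, by omega⟩ 1

/-- The support slots `(3/5) e_k + (4/5) e_{K+k}` of that configuration. -/
def modelSupport (hD : 2 * K ≤ D) (k : Fin K) : EuclideanSpace ℝ (Fin D) :=
  EuclideanSpace.single ⟨k, by omega⟩ (3 / 5) + EuclideanSpace.single ⟨K + k, by omega⟩ (4 / 5)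

theorem norm_modelQuery (hD : 2 * K ≤ D) (k : Fin K) : ‖modelQuery hD k‖ = 1 := by
  simp [modelQuery]

theorem norm_modelSupport (hD : 2 * K ≤ D) (k : Fin K) : ‖modelSupport hD k‖ = 1 := by
  have hne : (⟨k, by omega⟩ : Fin D) ≠ ⟨K + k, by omega⟩ := by
    simp only [ne_eq, Fin.mk.injEq]
    omega
  have h : ‖modelSupport hD k‖ ^ 2 = 1 := by
    rw [← real_inner_self_eq_norm_sq, modelSupport, inner_add_left,
      EuclideanSpace.inner_single_left, EuclideanSpace.inner_single_left]
    simp [hne, hne.symm]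
    norm_num
  exact (pow_eq_one_iff_of_nonneg (norm_nonneg _) two_ne_zero).1 h

theorem inner_modelQuery_modelSupport (hD : 2 * K ≤ D) (i j : Fin K) :
    inner ℝ (modelQuery hD i) (modelSupport hD j) = if i = j then (3 / 5 : ℝ) else 0 := by
  have h1 : (⟨i, by omega⟩ : Fin D) ≠ ⟨K + j, by omega⟩ := by
    simp only [ne_eq, Fin.mk.injEq]
    omega
  by_cases h : i = j
  · subst h
    simp [modelQuery, modelSupport, EuclideanSpace.inner_single_left, h1]
  · have h2 : (⟨i, by omega⟩ : Fin D) ≠ ⟨j, by omega⟩ := by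
      simp only [ne_eq, Fin.mk.injEq]
      omega
    simp [modelQuery, modelSupport, EuclideanSpace.inner_single_left, h1, h2, h]

theorem simFun_model (hD : 2 * K ≤ D) (i j : Fin K) :
    simFun (modelQuery hD) (modelSupport hD) i j = if i = j then (3 / 5 : ℝ) else 0 := by
  rw [simFun, cosSim, norm_modelQuery, norm_modelSupport, inner_modelQuery_modelSupport]
  simp

theorem hardGrad_model_apply (hD : 2 * K ≤ D) (k j : Fin K) :
    hardGrad (modelQuery hD) (modelSupport hD) id k ⟨K + j, by omega⟩ =
      if k = j then 1 / (K : ℝ) * (4 / 5) else 0 := by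
  have h1 : (⟨K + j, by omega⟩ : Fin D) ≠ ⟨k, by omega⟩ := by
    simp only [ne_eq, Fin.mk.injEq]
    omega
  by_cases h : k = j
  · subst h
    simp [hardGrad, perpProj, modelQuery, modelSupport, h1]
  · have h2 : (⟨K + j, by omega⟩ : Fin D) ≠ ⟨K + k, by omega⟩ := by
      simp only [ne_eq, Fin.mk.injEq]
      omega
    simp [hardGrad, perpProj, modelQuery, modelSupport, h1, h2, h]

/-- The model has row gap `3/5`, so the two gradient estimates apply with `σ = id`. The bound `ε ≤
1` lets the direct error `e^{-c/ε}` be absorbed into `ε⁻¹ e^{-c/ε}`, turning `4 + 4` into `8`. -/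
theorem abs_jacobian_model_sub_le {ε : ℝ} (hε : 0 < ε) (hε1 : ε ≤ 1) (hD : 2 * K ≤ D)
    (k j : Fin K) :
    |jacobian ε (modelQuery hD) (modelSupport hD) k ⟨K + j, by omega⟩ -
      (if k = j then 1 / (K : ℝ) * (4 / 5) else 0)| ≤
      8 * (K : ℝ) ^ 2 * (ε⁻¹ * Real.exp (-(3 / 5) / ε)) := by
  have hgap : ∀ i j : Fin K, j ≠ id i → simFun (modelQuery hD) (modelSupport hD) i j + 3 / 5 ≤
      simFun (modelQuery hD) (modelSupport hD) i (id i) := by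
    intro i j hij
    have hij' : i ≠ j := fun h => hij h.symm
    simp [simFun_model, hij']
  have h1 := norm_indirectGrad_le hε (norm_modelQuery hD) (norm_modelSupport hD)
    Function.bijective_id hgap k
  have h2 := norm_directGrad_sub_hardGrad_le hε (norm_modelQuery hD) (norm_modelSupport hD)
    Function.bijective_id hgap k
  rw [← hardGrad_model_apply hD k j]
  set G := fullGrad ε (modelQuery hD) (modelSupport hD) k with hG
  set F := hardGrad (modelQuery hD) (modelSupport hD) id k
  have hfull := fullGrad_eq hε (norm_modelQuery hD) (norm_modelSupport hD) k
  have h3 : ‖G - F‖ ≤ 4 * (K : ℝ) ^ 2 * Real.exp (-(3 / 5) / ε) +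
      4 * (K : ℝ) ^ 2 * (ε⁻¹ * Real.exp (-(3 / 5) / ε)) := by
    have e : G - F = (directGrad ε (modelQuery hD) (modelSupport hD) k - F) +
        indirectGrad ε (modelQuery hD) (modelSupport hD) k := by
      rw [hG, hfull]
      abel
    rw [e]
    exact (norm_add_le _ _).trans (add_le_add h2 h1)
  have h4 : |G ⟨K + j, by omega⟩ - F ⟨K + j, by omega⟩| ≤ ‖G - F‖ :=
    PiLp.norm_apply_le (G - F) _
  have h5 : Real.exp (-(3 / 5) / ε) ≤ ε⁻¹ * Real.exp (-(3 / 5) / ε) :=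
    le_mul_of_one_le_left (Real.exp_pos _).le ((one_le_inv₀ hε).2 hε1)
  have h6 : 4 * (K : ℝ) ^ 2 * Real.exp (-(3 / 5) / ε) ≤
      4 * (K : ℝ) ^ 2 * (ε⁻¹ * Real.exp (-(3 / 5) / ε)) :=
    mul_le_mul_of_nonneg_left h5 (by positivity)
  refine h4.trans (h3.trans ?_)
  linarith

theorem gramDet_model_ne_zero {ε : ℝ} (hε : 0 < ε) (hε1 : ε ≤ 1) (hK : 0 < K) (hD : 2 * K ≤ D)
    (hsmall : ε⁻¹ * Real.exp (-(3 / 5) / ε) < 1 / (10 * (K : ℝ) ^ 4)) :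
    gramDet ε (modelQuery hD, modelSupport hD) ≠ 0 := by
  have hK' : (0 : ℝ) < K := by exact_mod_cast hK
  refine gramDet_ne_zero_of_det_mul_ne_zero
    -- This matrix selects the coordinates `K + j`, in which the hard gradients form the diagonal
    -- matrix `4 / (5K)`.
    (Matrix.of fun i j => if i = (⟨K + j, by omega⟩ : Fin D) then (1 : ℝ) else 0) ?_
  set M := jacobian ε (modelQuery hD) (modelSupport hD) * (Matrix.of fun i j =>
    if i = (⟨K + (j : Fin K), by omega⟩ : Fin D) then (1 : ℝ) else 0) with hM
  have hMe : ∀ k j, M k j = jacobian ε (modelQuery hD) (modelSupport hD) k ⟨K + j, by omega⟩ := by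
    intro k j
    simp [hM, Matrix.mul_apply]
  set η := 8 * (K : ℝ) ^ 2 * (ε⁻¹ * Real.exp (-(3 / 5) / ε)) with hη
  have hη0 : 0 ≤ η := by positivity
  -- The bound `1 / (10 K⁴)` is chosen so that `8 K³ / (10 K⁴) = 4 / (5K)`. This gives `(K - 1) η <
  -- 4 / (5K) - η`, which is strict diagonal dominance.
  have hηs : K * η < 1 / (K : ℝ) * (4 / 5) := by
    have : K * η = 8 * (K : ℝ) ^ 3 * (ε⁻¹ * Real.exp (-(3 / 5) / ε)) := by
      rw [hη]
      ring
    rw [this]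
    refine (mul_lt_mul_of_pos_left hsmall (by positivity)).trans_eq ?_
    field_simp
    norm_num
  refine det_ne_zero_of_sum_row_lt_diag fun k => ?_
  have hoff : ∑ j ∈ Finset.univ.erase k, ‖M k j‖ ≤ (K - 1) * η := by
    have hcard : ((Finset.univ.erase k).card : ℝ) = K - 1 := by
      rw [Finset.card_erase_of_mem (Finset.mem_univ k), Finset.card_univ, Fintype.card_fin,
        Nat.cast_sub hK, Nat.cast_one]
    rw [← hcard, ← nsmul_eq_mul]
    refine Finset.sum_le_card_nsmul _ _ _ fun j hj => ?_
    have h := abs_jacobian_model_sub_le hε hε1 hD k j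
    rw [if_neg (Finset.ne_of_mem_erase hj).symm, sub_zero, ← hMe] at h
    exact h
  have hdiag : 1 / (K : ℝ) * (4 / 5) - η ≤ ‖M k k‖ := by
    have h := abs_jacobian_model_sub_le hε hε1 hD k k
    rw [if_pos rfl, ← hMe] at h
    have h2 := (abs_le.1 h).1
    have h3 := le_abs_self (M k k)
    rw [Real.norm_eq_abs]
    linarith
  linarith

theorem exists_threshold_rank (K : ℕ) (hK : 0 < K) :
    ∃ εcrit : ℝ, 0 < εcrit ∧ ∀ D : ℕ, 2 * K ≤ D → ∀ ε : ℝ, 0 < ε → ε < εcrit →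
      surfaceMeasure K D {z | (jacobian ε (vecs z.1) (vecs z.2)).rank < K} = 0 := by
  have hK' : (0 : ℝ) < K := by exact_mod_cast hK
  have hlim := tendsto_inv_mul_exp_neg_div (show (0 : ℝ) < 3 / 5 by norm_num)
  have hev := hlim.eventually_lt_const (show (0 : ℝ) < 1 / (10 * (K : ℝ) ^ 4) by positivity)
  obtain ⟨u, hu, hsub⟩ := mem_nhdsGT_iff_exists_Ioo_subset.1 hev
  refine ⟨min u 1, lt_min hu one_pos, fun D hD ε hε hlt => ?_⟩
  have hsmall : ε⁻¹ * Real.exp (-(3 / 5) / ε) < 1 / (10 * (K : ℝ) ^ 4) :=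
    hsub ⟨hε, hlt.trans_le (min_le_left _ _)⟩
  exact surfaceMeasure_rank_lt_eq_zero hε hK (by omega)
    (p := (modelQuery hD, modelSupport hD)) (norm_modelQuery hD) (norm_modelSupport hD)
    (gramDet_model_ne_zero hε (hlt.le.trans (min_le_right _ _)) hK hD hsmall)

end SlotMatching
end

theorem mainTheorem7 (K : ℕ) (hK : 2 ≤ K) (δ : ℝ) (hδ : 0 < δ) :
    ∃ εcrit C c : ℝ, 0 < εcrit ∧ 0 < C ∧ 0 < c ∧
      ∀ D : ℕ,
        (∀ (zq zc : Fin K → SlotMatching.Sph D) (kstar : Fin K → Fin K),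
          SlotMatching.minGap
            (SlotMatching.simMatrix (SlotMatching.vecs zq) (SlotMatching.vecs zc)) = δ →
          SlotMatching.IsRowArgmax
            (SlotMatching.simMatrix (SlotMatching.vecs zq) (SlotMatching.vecs zc)) kstar →
          Function.Bijective kstar →
          ∀ k : Fin K,
            (∀ ε : ℝ, 0 < ε → ε < εcrit →
              1 - C * Real.exp (-c / ε) ≤
                SlotMatching.coupling ε (SlotMatching.vecs zq) (SlotMatching.vecs zc)
                  k (kstar k) ∧
              ‖SlotMatching.directGrad ε (SlotMatching.vecs zq) (SlotMatching.vecs zc) k -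
                  SlotMatching.hardGrad (SlotMatching.vecs zq) (SlotMatching.vecs zc) kstar k‖ ≤
                C * Real.exp (-c / ε) ∧
              (∀ j j' : Fin K, DifferentiableAt ℝ
                (SlotMatching.couplingEntry ε (SlotMatching.vecs zq) (SlotMatching.vecs zc) k j j')
                (SlotMatching.vecs zq k)) ∧
              SlotMatching.fullGrad ε (SlotMatching.vecs zq) (SlotMatching.vecs zc) k =
                SlotMatching.directGrad ε (SlotMatching.vecs zq) (SlotMatching.vecs zc) k +
                  SlotMatching.indirectGrad ε (SlotMatching.vecs zq) (SlotMatching.vecs zc) k ∧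
              ‖SlotMatching.indirectGrad ε (SlotMatching.vecs zq) (SlotMatching.vecs zc) k‖ ≤
                C * (ε⁻¹ * Real.exp (-c / ε))) ∧
            Filter.Tendsto
              (fun ε : ℝ =>
                SlotMatching.indirectGrad ε (SlotMatching.vecs zq) (SlotMatching.vecs zc) k)
              (nhdsWithin 0 (Set.Ioi 0)) (nhds 0)) ∧
        (2 * K ≤ D →
          ∀ μ : MeasureTheory.Measure
              ((Fin K → SlotMatching.Sph D) × (Fin K → SlotMatching.Sph D)),
            MeasureTheory.IsProbabilityMeasure μ →
            MeasureTheory.Measure.AbsolutelyContinuous μ (SlotMatching.surfaceMeasure K D) →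
            ∀ ε : ℝ, 0 < ε → ε < εcrit →
              μ {z | (SlotMatching.jacobian ε (SlotMatching.vecs z.1)
                (SlotMatching.vecs z.2)).rank < K} = 0) := by
  obtain ⟨εcrit, hεcrit, hrank⟩ := SlotMatching.exists_threshold_rank K (by omega)
  have hK' : (0 : ℝ) < K := by
    exact_mod_cast (by omega : 0 < K)
  -- The rate is the gap itself, and `4 K²` dominates the constants of all three estimates. The
  -- threshold is the one that makes the model configuration nondegenerate.
  refine ⟨εcrit, 4 * (K : ℝ) ^ 2, δ, hεcrit, by positivity, hδ, fun D => ⟨?_, ?_⟩⟩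
  · intro zq zc σ hgap hmax hσ k
    have hq : ∀ k, ‖SlotMatching.vecs zq k‖ = 1 := fun k => by simp [SlotMatching.vecs]
    have hc : ∀ k, ‖SlotMatching.vecs zc k‖ = 1 := fun k => by simp [SlotMatching.vecs]
    have hg : ∀ i j, j ≠ σ i →
        SlotMatching.simFun (SlotMatching.vecs zq) (SlotMatching.vecs zc) i j + δ ≤
          SlotMatching.simFun (SlotMatching.vecs zq) (SlotMatching.vecs zc) i (σ i) :=
      SlotMatching.gap_of_minGap hgap hmax
    refine ⟨fun ε hε _ => ⟨?_, SlotMatching.norm_directGrad_sub_hardGrad_le hε hq hc hσ hg k,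
      fun j j' => (SlotMatching.hasFDerivAt_couplingEntry hε hq hc k j j').differentiableAt,
      SlotMatching.fullGrad_eq hε hq hc k,
      SlotMatching.norm_indirectGrad_le hε hq hc hσ hg k⟩, ?_⟩
    · have h := SlotMatching.one_sub_sinkhornFun_le hε hσ hg k
      rw [SlotMatching.coupling_eq_sinkhornFun]
      have : 0 < (K : ℝ) ^ 2 * Real.exp (-δ / ε) := by positivity
      linarith
    · have h := (SlotMatching.tendsto_inv_mul_exp_neg_div hδ).const_mul (4 * (K : ℝ) ^ 2)
      rw [mul_zero] at h
      refine squeeze_zero_norm' ?_ h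
      filter_upwards [self_mem_nhdsWithin] with ε hε
      exact SlotMatching.norm_indirectGrad_le hε hq hc hσ hg k
  · intro hD μ _ hμ ε hε hlt
    exact hμ (hrank D hD ε hε hlt)
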